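/- Let $n\ge 1$ and let $K\subset\mathbb{R}^n$ be a convex body (compact, convex, with non-empty interior). Write $|\cdot|$ for $n$-dimensional volume and $v_n$ for the volume of the Euclidean unit ball, and for $x\in K$ let $K^x=\{y\in\mathbb{R}^n:\langle y,z-x\rangle\le 1\text{ for all }z\in K\}$. Assume that the Santaló point of $K$, that is, the point $x\in\operatorname{int}K$ at which $|K||K^x|$ is minimal, is the origin. For $t\in\mathbb{R}$ let $$S(K,t)=\Big\{x\in K:\ \frac{|K||K^x|}{v_n^2}\le t\Big\}$$ (with $|K^x|=\infty$ allowed), and assume that $S(K,t)\neq\emptyset$. Put $r=\dfrac{|K||K^0|}{t\,v_n^2}$. Then: (i) $\big(1-r^{1/n}\big)K\subseteq S(K,t)\subseteq\big(1-\tfrac{r}{e}\big)K$. (ii) If in addition $K$ is symmetric, i.e. $K=-K$, then $\big(1-r^{1/n}\big)K\subseteq S(K,t)\subseteq(1-r)^{1/2}K$. -/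

import Mathlib

open MeasureTheory Set
open scoped ENNReal Pointwise

/-- The polar `K^x = (K - x)^0 = {y : ⟨y, z - x⟩ ≤ 1 for all z ∈ K}` of `K` with respect to `x`. -/
def polarAt {n : ℕ} (K : Set (EuclideanSpace ℝ (Fin n))) (x : EuclideanSpace ℝ (Fin n)) :
    Set (EuclideanSpace ℝ (Fin n)) :=
  {y | ∀ z ∈ K, inner ℝ y (z - x) ≤ 1}

/-- The volume `v_n` of the Euclidean unit ball of `ℝⁿ`. -/
noncomputable def ballVolume (n : ℕ) : ℝ≥0∞ :=
  volume (Metric.closedBall (0 : EuclideanSpace ℝ (Fin n)) 1)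

/-- The Santaló region `S(K, t) = {x ∈ K : |K| |K^x| / v_n² ≤ t}`. Volumes are taken in `[0, ∞]`,
because `|K^x| = ∞` when `x` is a boundary point of `K`. For `t < 0` no `x` satisfies the
inequality when `K` has interior points: the left side is then positive, the right side `0`. -/
def santaloRegion {n : ℕ} (K : Set (EuclideanSpace ℝ (Fin n))) (t : ℝ) :
    Set (EuclideanSpace ℝ (Fin n)) :=
  {x | x ∈ K ∧ volume K * volume (polarAt K x) / ballVolume n ^ 2 ≤ ENNReal.ofReal t}

/-- `x₀` is a Santaló point of `K`: an interior point of `K` at which `x ↦ |K| |K^x|` attains its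
minimum over the interior of `K`. -/
def IsSantaloPoint {n : ℕ} (K : Set (EuclideanSpace ℝ (Fin n))) (x₀ : EuclideanSpace ℝ (Fin n)) :
    Prop :=
  x₀ ∈ interior K ∧
    ∀ x ∈ interior K, volume K * volume (polarAt K x₀) ≤ volume K * volume (polarAt K x)

/-- The number `|K| |K^0| / (t v_n²)`, where `K^0` is the polar with respect to the origin. -/
noncomputable def santaloRatio {n : ℕ} (K : Set (EuclideanSpace ℝ (Fin n))) (t : ℝ) : ℝ :=
  (volume K).toReal * (volume (polarAt K 0)).toReal / (t * (ballVolume n).toReal ^ 2)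

/-!
Write `L` for the polar of `K` at the origin, and `ℓ y = ⟨x, y⟩` for a given point `x`. The inner
inclusion is a scaling argument: `(1 - q) z + q K ⊆ K` for `z ∈ K`, so the polar of `K` at
`(1 - q) z` lies in `q⁻¹ L` (`volume_polarAt_smul_le`).

For the outer inclusions, by the bipolar theorem (`mem_smul_of_forall_inner_le`), it is enough to
bound `ℓ` on `L`, and that follows from lower bounds for `|K^x|` in terms of `|L|`.

* General `K`. For `y₀ ∈ L` with `μ = ℓ y₀ ∈ (0, 1)`, the linear map
  `y ↦ y + (1 - μ)⁻¹ ℓ(y) y₀` has determinant `(1 - μ)⁻¹` and sends the cap `L ∩ {ℓ ≥ 0}` into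
  `K^x` (`add_smul_mem_polarAt`). Hence `(1 - μ) |K^x| ≥ |L ∩ {ℓ ≥ 0}|`. As the origin is the
  Santaló point, the first variation of `|K^x| = ∫_L (1 - ℓ)⁻⁽ⁿ⁺¹⁾` shows that the centroid of `L`
  is the origin, so the cap has volume at least `|L| / e` by Grünbaum's inequality
  (`volume_le_exp_mul_volume_inter_halfSpace`). The same linear maps, with coefficients tending to
  infinity, show that `|K^x| = ∞` as soon as `ℓ` reaches `1` on `L`.
* Grünbaum's inequality. By Prékopa–Leindler the function `s ↦ |L ∩ {ℓ ≥ s}|` is log-concave,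
  hence lies below an exponential touching it at `s = 0`; integrating this bound against the
  vanishing of `∫_L ℓ` gives the constant `e`.
* Symmetric `K`. Let `μ` be the maximum of `ℓ` on `L`. Then
  `2 |K^x| = ∫_L ((1 - ℓ)⁻⁽ⁿ⁺¹⁾ + (1 + ℓ)⁻⁽ⁿ⁺¹⁾)`, with an integrand increasing in `|ℓ|`.
  Contracting `L` towards a maximum point of `ℓ` gives `|L ∩ {|ℓ| ≥ t}| ≥ (1 - t / μ)ⁿ |L|`, with
  equality for a double cone, for which the integral is `2 |L| / (1 - μ²)`
  (`inv_one_sub_sq_mul_volume_polarAt_le`).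
-/

/-! ### The Prékopa–Leindler and Brunn–Minkowski inequalities -/

/-- The translates `A + min B` and `max A + B` lie in `A + B` and meet in a single point. -/
theorem volume_add_le_of_isCompact {A B : Set ℝ} (hA : IsCompact A) (hB : IsCompact B)
    (hA' : A.Nonempty) (hB' : B.Nonempty) : volume A + volume B ≤ volume (A + B) := by
  obtain ⟨a, haA, ha⟩ := hA.exists_isGreatest hA'
  obtain ⟨b, hbB, hb⟩ := hB.exists_isLeast hB'
  have h1 : A + {b} ⊆ A + B := add_subset_add_left (by simpa using hbB)
  have h2 : {a} + B ⊆ A + B := add_subset_add_right (by simpa using haA)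
  have hi : volume ((A + {b}) ∩ ({a} + B)) = 0 := by
    refine measure_mono_null (t := {a + b}) ?_ (by simp)
    rintro x ⟨⟨y, hy, z, hz, rfl⟩, ⟨y', hy', z', hz', h⟩⟩
    simp only [mem_singleton_iff] at *
    subst hz hy'
    have := ha hy
    have := hb hz'
    linarith
  have hm : MeasurableSet ({a} + B) := (isCompact_singleton.add hB).measurableSet
  calc volume A + volume B = volume (A + {b}) + volume ({a} + B) := by
        congr 1
        · rw [Set.add_singleton, ← measure_preimage_add_right volume (-b) A]
          simp
        · simp [Set.singleton_add]
    _ = volume ((A + {b}) ∪ ({a} + B)) := by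
        rw [← measure_union_add_inter _ hm, hi, add_zero]
    _ ≤ volume (A + B) := measure_mono (union_subset h1 h2)

/-- One-dimensional Brunn–Minkowski inequality. The sumset need not be measurable, and `volume` is then
its outer measure. -/
theorem volume_add_le {A B : Set ℝ} (hA : MeasurableSet A) (hB : MeasurableSet B)
    (hA' : A.Nonempty) (hB' : B.Nonempty) : volume A + volume B ≤ volume (A + B) := by
  obtain ⟨a, ha⟩ := hA'
  obtain ⟨b, hb⟩ := hB'
  have key : ∀ S ⊆ A, IsCompact S → ∀ T ⊆ B, IsCompact T →
      volume S + volume T ≤ volume (A + B) := by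
    intro S hS hSc T hT hTc
    calc volume S + volume T ≤ volume (insert a S) + volume (insert b T) := by
          gcongr <;> exact subset_insert _ _
      _ ≤ volume (insert a S + insert b T) :=
          volume_add_le_of_isCompact (hSc.insert a) (hTc.insert b) (insert_nonempty _ _)
            (insert_nonempty _ _)
      _ ≤ volume (A + B) := measure_mono
          (add_subset_add (insert_subset ha hS) (insert_subset hb hT))
  rw [hA.measure_eq_iSup_isCompact, hB.measure_eq_iSup_isCompact]
  simp only [iSup_and', iSup_subtype']
  have : Nonempty {S : Set ℝ // S ⊆ A ∧ IsCompact S} := ⟨⟨∅, by simp⟩⟩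
  have : Nonempty {S : Set ℝ // S ⊆ B ∧ IsCompact S} := ⟨⟨∅, by simp⟩⟩
  refine ENNReal.iSup_add_iSup_le ?_
  intro S T
  exact key _ S.2.1 S.2.2 _ T.2.1 T.2.2

/-- The measure `μ` satisfies the Prékopa–Leindler inequality with weights `1 - c` and `c`. -/
def PrekopaLeindler {E : Type*} [AddCommGroup E] [Module ℝ E] [MeasurableSpace E]
    (μ : Measure E) (c : ℝ) : Prop :=
  ∀ f g h : E → ℝ≥0∞, Measurable f → Measurable g → Measurable h →
    (∀ x y, f x ^ (1 - c) * g y ^ c ≤ h ((1 - c) • x + c • y)) →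
    (∫⁻ x, f x ∂μ) ^ (1 - c) * (∫⁻ x, g x ∂μ) ^ c ≤ ∫⁻ x, h x ∂μ

/-- Layer cake formula for a function with values in `[0, 1]`. -/
theorem lintegral_eq_setLIntegral_superlevel {f : ℝ → ℝ≥0∞} (hf : Measurable f) (h1 : ∀ x, f x ≤ 1) :
    ∫⁻ x, f x = ∫⁻ t in Ioo (0 : ℝ) 1, volume {x | ENNReal.ofReal t < f x} := by
  have hfin : ∀ x, f x ≠ ∞ := fun x => ne_top_of_le_ne_top ENNReal.one_ne_top (h1 x)
  have h2 : ∫⁻ x, f x = ∫⁻ x, ENNReal.ofReal (f x).toReal := by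
    simp [ENNReal.ofReal_toReal (hfin _)]
  have hset : ∀ t ∈ Ioi (0 : ℝ), volume {x | t < (f x).toReal}
      = volume {x | ENNReal.ofReal t < f x} := by
    intro t ht
    congr 1
    ext x
    simp [ENNReal.ofReal_lt_iff_lt_toReal (le_of_lt ht) (hfin x)]
  rw [h2, lintegral_eq_lintegral_meas_lt _ (by filter_upwards; intro; positivity)
    hf.ennreal_toReal.aemeasurable, setLIntegral_congr_fun measurableSet_Ioi hset]
  have hz : ∫⁻ t in Ici (1 : ℝ), volume {x | ENNReal.ofReal t < f x} = 0 := by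
    rw [setLIntegral_congr_fun (g := 0) measurableSet_Ici]
    · simp
    · intro t ht
      have : {x | ENNReal.ofReal t < f x} = ∅ := by
        ext x
        simp only [mem_ofPred_eq, mem_empty_iff_false, iff_false, not_lt]
        exact (h1 x).trans (by simpa using ht)
      simp [this]
  rw [← Ioo_union_Ici_eq_Ioi (zero_lt_one' ℝ), lintegral_union measurableSet_Ici, hz, add_zero]
  exact Set.disjoint_left.2 fun x hx hx' => absurd hx.2 (not_lt.2 hx')

/-- When `f` and `g` have the same supremum, their superlevel sets are nonempty for the same levels, so
the one-dimensional Brunn–Minkowski inequality applies level by level and yields even the arithmetic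
mean of the two integrals. -/
theorem add_lintegral_le_of_iSup_eq_one {c : ℝ} (h0 : 0 < c) (h1 : c < 1) {f g h : ℝ → ℝ≥0∞}
    (hf : Measurable f) (hg : Measurable g) (hh : Measurable h)
    (hfs : ⨆ x, f x = 1) (hgs : ⨆ x, g x = 1)
    (H : ∀ x y, f x ^ (1 - c) * g y ^ c ≤ h ((1 - c) * x + c * y)) :
    ENNReal.ofReal (1 - c) * (∫⁻ x, f x) + ENNReal.ofReal c * (∫⁻ x, g x) ≤ ∫⁻ x, h x := by
  have hf1 : ∀ x, f x ≤ 1 := fun x => hfs ▸ le_iSup f x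
  have hg1 : ∀ x, g x ≤ 1 := fun x => hgs ▸ le_iSup g x
  have hc : 0 < 1 - c := by linarith
  have hm : ∀ {φ : ℝ → ℝ≥0∞}, Measurable φ → ∀ t : ℝ, MeasurableSet {x | ENNReal.ofReal t < φ x} :=
    fun hφ t => measurableSet_lt measurable_const hφ
  calc _ = ∫⁻ t in Ioo (0 : ℝ) 1, (ENNReal.ofReal (1 - c) * volume {x | ENNReal.ofReal t < f x}
          + ENNReal.ofReal c * volume {x | ENNReal.ofReal t < g x}) := by
        have hanti : ∀ φ : ℝ → ℝ≥0∞, Measurable fun t : ℝ => volume {x | ENNReal.ofReal t < φ x} :=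
          fun φ => Antitone.measurable fun s t hst => measure_mono fun x hx =>
            (ENNReal.ofReal_le_ofReal hst).trans_lt hx
        rw [lintegral_eq_setLIntegral_superlevel hf hf1, lintegral_eq_setLIntegral_superlevel hg hg1,
          lintegral_add_left ((hanti f).const_mul _), lintegral_const_mul _ (hanti f),
          lintegral_const_mul _ (hanti g)]
    _ ≤ ∫⁻ t in Ioo (0 : ℝ) 1, volume {x | ENNReal.ofReal t < min (h x) 1} := by
        refine setLIntegral_mono' measurableSet_Ioo fun t ht => ?_
        have ht1 : ENNReal.ofReal t < 1 := by simpa using ht.2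
        obtain ⟨a, ha⟩ := lt_iSup_iff.1 (hfs ▸ ht1)
        obtain ⟨b, hb⟩ := lt_iSup_iff.1 (hgs ▸ ht1)
        have e1 : ENNReal.ofReal (1 - c) * volume {x | ENNReal.ofReal t < f x}
            = volume ((1 - c) • {x | ENNReal.ofReal t < f x}) := by
          rw [Measure.addHaar_smul]; simp [abs_of_pos hc]
        have e2 : ENNReal.ofReal c * volume {x | ENNReal.ofReal t < g x}
            = volume (c • {x | ENNReal.ofReal t < g x}) := by
          rw [Measure.addHaar_smul]; simp [abs_of_pos h0]
        rw [e1, e2]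
        refine (volume_add_le ((hm hf t).const_smul₀ _) ((hm hg t).const_smul₀ _)
          ⟨_, smul_mem_smul_set ha⟩ ⟨_, smul_mem_smul_set hb⟩).trans (measure_mono ?_)
        rintro _ ⟨_, ⟨x, hx, rfl⟩, _, ⟨y, hy, rfl⟩, rfl⟩
        simp only [mem_ofPred_eq, smul_eq_mul] at *
        refine lt_min (lt_of_lt_of_le ?_ (H x y)) ht1
        calc ENNReal.ofReal t = ENNReal.ofReal t ^ (1 - c) * ENNReal.ofReal t ^ c := by
              rw [← ENNReal.rpow_add_of_nonneg _ _ hc.le h0.le]; simp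
          _ < f x ^ (1 - c) * g y ^ c :=
              ENNReal.mul_lt_mul (ENNReal.rpow_lt_rpow hx hc) (ENNReal.rpow_lt_rpow hy h0)
    _ = ∫⁻ x, min (h x) 1 :=
        (lintegral_eq_setLIntegral_superlevel (hh.min measurable_const) fun x => min_le_right _ _).symm
    _ ≤ ∫⁻ x, h x := lintegral_mono fun x => min_le_left _ _

/-- Weighted AM–GM inequality for two elements of `[0, ∞]`. -/
theorem geom_mean_le_arith_mean {c : ℝ} (h0 : 0 < c) (h1 : c < 1) (a b : ℝ≥0∞) :
    a ^ (1 - c) * b ^ c ≤ ENNReal.ofReal (1 - c) * a + ENNReal.ofReal c * b := by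
  have hc : 0 < 1 - c := by linarith
  rcases eq_or_ne a ∞ with rfl | ha
  · rw [ENNReal.mul_top (by simpa using hc)]
    simp
  rcases eq_or_ne b ∞ with rfl | hb
  · rw [ENNReal.mul_top (by simpa using h0)]
    simp
  lift a to NNReal using ha
  lift b to NNReal using hb
  have := NNReal.geom_mean_le_arith_mean2_weighted (Real.toNNReal (1 - c)) (Real.toNNReal c) a b
    (by rw [← Real.toNNReal_add hc.le h0.le]; simp)
  rw [Real.coe_toNNReal _ hc.le, Real.coe_toNNReal _ h0.le] at this
  rw [← ENNReal.coe_rpow_of_nonneg _ hc.le, ← ENNReal.coe_rpow_of_nonneg _ h0.le, ENNReal.ofReal,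
    ENNReal.ofReal]
  exact_mod_cast this

/-- Bounded functions are normalised to have supremum `1`; the general case follows by truncation. -/
theorem prekopaLeindler_real {c : ℝ} (h0 : 0 < c) (h1 : c < 1) :
    PrekopaLeindler (volume : Measure ℝ) c := by
  have hc : 0 < 1 - c := by linarith
  have bdd : ∀ f g h : ℝ → ℝ≥0∞, Measurable f → Measurable g → Measurable h →
      (⨆ x, f x) ≠ ∞ → (⨆ x, g x) ≠ ∞ →
      (∀ x y, f x ^ (1 - c) * g y ^ c ≤ h ((1 - c) • x + c • y)) →
      (∫⁻ x, f x) ^ (1 - c) * (∫⁻ x, g x) ^ c ≤ ∫⁻ x, h x := by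
    intro f g h hf hg hh hft hgt H
    set a := ⨆ x, f x with ha
    set b := ⨆ x, g x with hb
    rcases eq_or_ne a 0 with ha0 | ha0
    · have : f = 0 := by
        funext x; exact le_antisymm ((le_iSup f x).trans_eq ha0) bot_le
      simp [this, hc]
    rcases eq_or_ne b 0 with hb0 | hb0
    · have : g = 0 := by
        funext x; exact le_antisymm ((le_iSup g x).trans_eq hb0) bot_le
      simp [this, h0]
    set m := a ^ (1 - c) * b ^ c with hm
    have hm0 : m ≠ 0 := by
      simp [hm, ENNReal.rpow_eq_zero_iff, ha0, hb0, hft, hgt]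
    have hmt : m ≠ ∞ := ENNReal.mul_ne_top (ENNReal.rpow_ne_top_of_nonneg hc.le hft)
      (ENNReal.rpow_ne_top_of_nonneg h0.le hgt)
    have hmi : m⁻¹ = (a⁻¹) ^ (1 - c) * (b⁻¹) ^ c := by
      rw [hm, ENNReal.mul_inv (by simp [ENNReal.rpow_eq_zero_iff, ha0, hft])
        (by left; exact ENNReal.rpow_ne_top_of_nonneg hc.le hft), ENNReal.inv_rpow, ENNReal.inv_rpow]
    have key := add_lintegral_le_of_iSup_eq_one h0 h1 (hf.const_mul a⁻¹) (hg.const_mul b⁻¹)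
      (hh.const_mul m⁻¹)
      (by rw [← ENNReal.mul_iSup, ENNReal.inv_mul_cancel ha0 hft])
      (by rw [← ENNReal.mul_iSup, ENNReal.inv_mul_cancel hb0 hgt])
      (by
        intro x y
        rw [ENNReal.mul_rpow_of_nonneg _ _ hc.le, ENNReal.mul_rpow_of_nonneg _ _ h0.le, hmi,
          mul_mul_mul_comm]
        gcongr
        exact H x y)
    have key2 := (geom_mean_le_arith_mean h0 h1 (∫⁻ x, a⁻¹ * f x) (∫⁻ x, b⁻¹ * g x)).trans key
    rw [lintegral_const_mul _ hf, lintegral_const_mul _ hg, lintegral_const_mul _ hh,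
      ENNReal.mul_rpow_of_nonneg _ _ hc.le, ENNReal.mul_rpow_of_nonneg _ _ h0.le,
      mul_mul_mul_comm, ← hmi] at key2
    exact (ENNReal.mul_le_mul_iff_right (ENNReal.inv_ne_zero.2 hmt) (ENNReal.inv_ne_top.2 hm0)).1 key2
  intro f g h hf hg hh H
  have lim : ∀ φ : ℝ → ℝ≥0∞, Measurable φ →
      Filter.Tendsto (fun k : ℕ => ∫⁻ x, min (φ x) k) Filter.atTop (nhds (∫⁻ x, φ x)) := by
    intro φ hφ
    refine lintegral_tendsto_of_tendsto_of_monotone (fun k => (hφ.min measurable_const).aemeasurable)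
      ?_ ?_
    · filter_upwards with x i j hij
      exact min_le_min le_rfl (by exact_mod_cast hij)
    · filter_upwards with x
      have := (tendsto_const_nhds (x := φ x)).min ENNReal.tendsto_nat_nhds_top
      simpa using this
  have hb : ∀ k : ℕ, (∫⁻ x, min (f x) k) ^ (1 - c) * (∫⁻ x, min (g x) k) ^ c ≤ ∫⁻ x, h x := by
    intro k
    refine bdd _ _ h (hf.min measurable_const) (hg.min measurable_const) hh ?_ ?_ ?_
    · exact ne_top_of_le_ne_top (ENNReal.natCast_ne_top k) (iSup_le fun x => min_le_right _ _)
    · exact ne_top_of_le_ne_top (ENNReal.natCast_ne_top k) (iSup_le fun x => min_le_right _ _)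
    · intro x y
      refine le_trans ?_ (H x y)
      gcongr <;> exact min_le_left _ _
  rcases eq_or_ne (∫⁻ x, f x) 0 with hf0 | hf0
  · simp [hf0, hc]
  rcases eq_or_ne (∫⁻ x, g x) 0 with hg0 | hg0
  · simp [hg0, h0]
  refine le_of_tendsto' (ENNReal.Tendsto.mul
    ((ENNReal.continuous_rpow_const (y := 1 - c)).continuousAt.tendsto.comp (lim f hf))
    (Or.inl ?_)
    ((ENNReal.continuous_rpow_const (y := c)).continuousAt.tendsto.comp (lim g hg))
    (Or.inl ?_)) hb
  · simp [ENNReal.rpow_eq_zero_iff, hf0, hc.not_gt]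
  · simp [ENNReal.rpow_eq_zero_iff, hg0, h0.not_gt]

/-- The inequality tensorises: the partial integrals of `f`, `g`, `h` satisfy the hypothesis again. -/
theorem PrekopaLeindler.prod {E F : Type*} [AddCommGroup E] [Module ℝ E] [MeasurableSpace E]
    [AddCommGroup F] [Module ℝ F] [MeasurableSpace F] {μ : Measure E} {ν : Measure F} [SFinite ν]
    {c : ℝ} (hμ : PrekopaLeindler μ c) (hν : PrekopaLeindler ν c) :
    PrekopaLeindler (μ.prod ν) c := by
  intro f g h hf hg hh H
  rw [lintegral_prod _ hf.aemeasurable, lintegral_prod _ hg.aemeasurable,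
    lintegral_prod _ hh.aemeasurable]
  refine hμ _ _ _ hf.lintegral_prod_right' hg.lintegral_prod_right' hh.lintegral_prod_right' ?_
  intro x y
  refine hν _ _ _ (hf.comp measurable_prodMk_left) (hg.comp measurable_prodMk_left)
    (hh.comp measurable_prodMk_left) ?_
  intro u v
  exact H (x, u) (y, v)

theorem PrekopaLeindler.of_measurePreserving {E F : Type*} [AddCommGroup E] [Module ℝ E]
    [MeasurableSpace E] [AddCommGroup F] [Module ℝ F] [MeasurableSpace F] {μ : Measure E}
    {ν : Measure F} {c : ℝ} (hμ : PrekopaLeindler μ c) (e : E → F) (he : MeasurePreserving e μ ν)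
    (hlin : IsLinearMap ℝ e) : PrekopaLeindler ν c := by
  intro f g h hf hg hh H
  rw [← he.lintegral_comp hf, ← he.lintegral_comp hg, ← he.lintegral_comp hh]
  refine hμ _ _ _ (hf.comp he.measurable) (hg.comp he.measurable) (hh.comp he.measurable) ?_
  intro x y
  simp only [hlin.map_add, hlin.map_smul]
  exact H _ _

theorem prekopaLeindler_pi {c : ℝ} (h0 : 0 < c) (h1 : c < 1) (n : ℕ) :
    PrekopaLeindler (volume : Measure (Fin n → ℝ)) c := by
  induction n with
  | zero =>
    intro f g h _ _ _ H
    rw [volume_pi, Measure.pi_of_empty _ 0]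
    simp only [lintegral_dirac]
    refine (H 0 0).trans_eq ?_
    simp
  | succ n ih =>
    refine ((prekopaLeindler_real h0 h1).prod ih).of_measurePreserving _
      (volume_preserving_piFinSuccAbove (fun _ : Fin (n + 1) => ℝ) 0).symm ⟨?_, ?_⟩
    · rintro ⟨a, u⟩ ⟨b, v⟩
      funext i
      refine Fin.cases ?_ (fun j => ?_) i <;> simp [MeasurableEquiv.piFinSuccAbove]
    · rintro t ⟨a, u⟩
      funext i
      refine Fin.cases ?_ (fun j => ?_) i <;> simp [MeasurableEquiv.piFinSuccAbove]

theorem prekopaLeindler_euclideanSpace {c : ℝ} (h0 : 0 < c) (h1 : c < 1) (n : ℕ) :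
    PrekopaLeindler (volume : Measure (EuclideanSpace ℝ (Fin n))) c :=
  (prekopaLeindler_pi h0 h1 n).of_measurePreserving _ (PiLp.volume_preserving_toLp (Fin n))
    ⟨fun _ _ => rfl, fun _ _ => rfl⟩

/-- Multiplicative Brunn–Minkowski inequality, the case of indicators of Prékopa–Leindler. -/
theorem volume_rpow_mul_rpow_le {n : ℕ} {c : ℝ} (h0 : 0 < c) (h1 : c < 1)
    {A B C : Set (EuclideanSpace ℝ (Fin n))} (hA : MeasurableSet A) (hB : MeasurableSet B)
    (hC : MeasurableSet C) (H : ∀ x ∈ A, ∀ y ∈ B, (1 - c) • x + c • y ∈ C) :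
    volume A ^ (1 - c) * volume B ^ c ≤ volume C := by
  have hc : 0 < 1 - c := by linarith
  have := prekopaLeindler_euclideanSpace h0 h1 n (A.indicator 1) (B.indicator 1) (C.indicator 1)
    (measurable_one.indicator hA) (measurable_one.indicator hB) (measurable_one.indicator hC) ?_
  · simpa only [lintegral_indicator_one hA, lintegral_indicator_one hB,
      lintegral_indicator_one hC] using this
  intro x y
  by_cases hx : x ∈ A
  · by_cases hy : y ∈ B
    · simp [hx, hy, H x hx y hy]
    · simp [hy, h0]
  · simp [hx, hc]

/-! ### Grünbaum's inequality for a half-space through the centroid -/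

section Cap

variable {n : ℕ} {L : Set (EuclideanSpace ℝ (Fin n))}

theorem measurableSet_inter_halfSpace (hL : MeasurableSet L) (ℓ : EuclideanSpace ℝ (Fin n) →L[ℝ] ℝ)
    (s : ℝ) : MeasurableSet (L ∩ {y | s ≤ ℓ y}) :=
  hL.inter (measurableSet_le measurable_const ℓ.continuous.measurable)

theorem volume_inter_halfSpace_ne_top (hL : IsCompact L) (ℓ : EuclideanSpace ℝ (Fin n) →L[ℝ] ℝ)
    (s : ℝ) : volume (L ∩ {y | s ≤ ℓ y}) ≠ ∞ :=
  measure_ne_top_of_subset inter_subset_left hL.measure_lt_top.ne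

/-- The volume of the cap `L ∩ {ℓ ≥ s}` of a convex body is log-concave in `s`. -/
theorem log_volume_inter_halfSpace_concave (hL : IsCompact L) (hconv : Convex ℝ L)
    (ℓ : EuclideanSpace ℝ (Fin n) →L[ℝ] ℝ) {c a b : ℝ} (h0 : 0 < c) (h1 : c < 1)
    (ha : 0 < volume.real (L ∩ {y | a ≤ ℓ y})) (hb : 0 < volume.real (L ∩ {y | b ≤ ℓ y})) :
    (1 - c) * Real.log (volume.real (L ∩ {y | a ≤ ℓ y})) +
        c * Real.log (volume.real (L ∩ {y | b ≤ ℓ y})) ≤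
      Real.log (volume.real (L ∩ {y | (1 - c) * a + c * b ≤ ℓ y})) := by
  have hm := measurableSet_inter_halfSpace hL.measurableSet ℓ
  have key := volume_rpow_mul_rpow_le h0 h1 (hm a) (hm b) (hm ((1 - c) * a + c * b)) (by
    rintro x ⟨hx, hx'⟩ y ⟨hy, hy'⟩
    refine ⟨hconv hx hy (by linarith) h0.le (by ring), ?_⟩
    simp only [mem_ofPred_eq, map_add, map_smul, smul_eq_mul] at *
    have : 0 < 1 - c := by linarith
    gcongr)
  have key' := ENNReal.toReal_mono (volume_inter_halfSpace_ne_top hL ℓ _) key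
  rw [ENNReal.toReal_mul, ← ENNReal.toReal_rpow, ← ENNReal.toReal_rpow] at key'
  have hpos := mul_pos (Real.rpow_pos_of_pos ha (1 - c)) (Real.rpow_pos_of_pos hb c)
  have h := Real.log_le_log hpos key'
  rwa [Real.log_mul (Real.rpow_pos_of_pos ha _).ne' (Real.rpow_pos_of_pos hb _).ne',
    Real.log_rpow ha, Real.log_rpow hb] at h

theorem exists_pos_volume_inter_halfSpace_pos (hL : IsCompact L)
    (h0 : (0 : EuclideanSpace ℝ (Fin n)) ∈ interior L)
    {ℓ : EuclideanSpace ℝ (Fin n) →L[ℝ] ℝ} (hℓ : ℓ ≠ 0) :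
    ∃ b > 0, 0 < volume.real (L ∩ {y | b ≤ ℓ y}) := by
  obtain ⟨v, hv⟩ : ∃ v, 0 < ℓ v := by
    by_contra! h
    refine hℓ (ContinuousLinearMap.ext fun v => le_antisymm (h v) ?_)
    simpa using h (-v)
  have hev : ∀ᶠ δ : ℝ in nhdsWithin 0 (Ioi 0), δ • v ∈ interior L := by
    have : Filter.Tendsto (fun δ : ℝ => δ • v) (nhds 0) (nhds 0) := by
      have h : Continuous fun δ : ℝ => δ • v := by fun_prop
      simpa using h.tendsto 0
    exact (this.eventually (isOpen_interior.mem_nhds h0)).filter_mono nhdsWithin_le_nhds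
  obtain ⟨δ, hδ, hδ0⟩ := (hev.and self_mem_nhdsWithin).exists
  have hpos : 0 < ℓ (δ • v) := by
    rw [map_smul, smul_eq_mul]
    exact mul_pos hδ0 hv
  refine ⟨ℓ (δ • v) / 2, by positivity, ?_⟩
  have hopen : IsOpen (interior L ∩ {y | ℓ (δ • v) / 2 < ℓ y}) :=
    isOpen_interior.inter (isOpen_lt continuous_const ℓ.continuous)
  have := hopen.measure_pos volume ⟨δ • v, hδ, by simp only [mem_ofPred_eq]; linarith⟩
  refine ENNReal.toReal_pos (ne_of_gt (lt_of_lt_of_le this (measure_mono ?_)))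
    (volume_inter_halfSpace_ne_top hL ℓ _)
  refine inter_subset_inter interior_subset fun y hy => ?_
  simp only [mem_ofPred_eq] at hy ⊢
  exact hy.le

theorem antitone_volume_inter_halfSpace (hL : IsCompact L)
    (ℓ : EuclideanSpace ℝ (Fin n) →L[ℝ] ℝ) :
    Antitone fun s => volume.real (L ∩ {y | s ≤ ℓ y}) := fun _ _ hst =>
  ENNReal.toReal_mono (volume_inter_halfSpace_ne_top hL ℓ _)
    (measure_mono fun _ hy => ⟨hy.1, hst.trans hy.2⟩)

/-- A log-concave function lies below an exponential that touches it at `0`. Here `-k` is the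
supremum of the slopes, to the right of `0`, of the logarithm of the cap volume. -/
theorem exists_exp_bound_volume_inter_halfSpace (hL : IsCompact L) (hconv : Convex ℝ L)
    (h0 : (0 : EuclideanSpace ℝ (Fin n)) ∈ interior L) {ℓ : EuclideanSpace ℝ (Fin n) →L[ℝ] ℝ}
    (hℓ : ℓ ≠ 0) :
    ∃ k, 0 ≤ k ∧ ∀ s, volume.real (L ∩ {y | s ≤ ℓ y}) ≤
      volume.real (L ∩ {y | 0 ≤ ℓ y}) * Real.exp (-(k * s)) := by
  obtain ⟨b₀, hb₀, hFb₀⟩ := exists_pos_volume_inter_halfSpace_pos hL h0 hℓ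
  have hanti := antitone_volume_inter_halfSpace hL ℓ
  have hconc := fun {c a b : ℝ} =>
    log_volume_inter_halfSpace_concave hL hconv ℓ (c := c) (a := a) (b := b)
  set F : ℝ → ℝ := fun s => volume.real (L ∩ {y | s ≤ ℓ y}) with hF
  change ∀ {c a b : ℝ}, 0 < c → c < 1 → 0 < F a → 0 < F b →
    (1 - c) * Real.log (F a) + c * Real.log (F b) ≤ Real.log (F ((1 - c) * a + c * b)) at hconc
  change ∃ k, 0 ≤ k ∧ ∀ s, F s ≤ F 0 * Real.exp (-(k * s))
  have hF0 : 0 < F 0 := hFb₀.trans_le (hanti hb₀.le)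
  -- minus the slopes of `log F` from `0` to the points `b > 0` at which `F` does not vanish
  set S : Set ℝ := (fun b => (Real.log (F 0) - Real.log (F b)) / b) '' {b | 0 < b ∧ 0 < F b} with hS
  have hSne : S.Nonempty := ⟨_, b₀, ⟨hb₀, hFb₀⟩, rfl⟩
  have hS0 : ∀ x ∈ S, 0 ≤ x := by
    rintro _ ⟨b, ⟨hb, hFb⟩, rfl⟩
    exact div_nonneg (sub_nonneg.2 (Real.log_le_log hFb (hanti hb.le))) hb.le
  have hlog : ∀ s, 0 < F s → Real.log (F s) ≤ Real.log (F 0) - sInf S * s →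
      F s ≤ F 0 * Real.exp (-(sInf S * s)) := by
    intro s hs h
    have := Real.exp_le_exp.2 h
    rwa [Real.exp_log hs, sub_eq_add_neg, Real.exp_add, Real.exp_log hF0] at this
  refine ⟨sInf S, le_csInf hSne hS0, fun s => ?_⟩
  rcases lt_trichotomy s 0 with hs | rfl | hs
  · have hFs : 0 < F s := hF0.trans_le (hanti hs.le)
    refine hlog s hFs ?_
    have : (Real.log (F s) - Real.log (F 0)) / (-s) ≤ sInf S := by
      refine le_csInf hSne ?_
      rintro _ ⟨b, ⟨hb, hFb⟩, rfl⟩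
      have hbs : 0 < b - s := by linarith
      have h := hconc (c := -s / (b - s)) (a := s) (b := b) (div_pos (by linarith) hbs)
        ((div_lt_one hbs).2 (by linarith)) hFs hFb
      have e1 : 1 - -s / (b - s) = b / (b - s) := by field_simp; ring
      have e2 : b / (b - s) * s + -s / (b - s) * b = 0 := by field_simp; ring
      rw [e1, e2, ← sub_nonneg] at h
      have h' := mul_nonneg hbs.le h
      have e3 : (b - s) * (Real.log (F 0) - (b / (b - s) * Real.log (F s) +
          -s / (b - s) * Real.log (F b))) =
          (b - s) * Real.log (F 0) - (b * Real.log (F s) - s * Real.log (F b)) := by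
        field_simp; ring
      rw [e3] at h'
      rw [div_le_div_iff₀ (by linarith) hb]
      nlinarith
    rw [div_le_iff₀ (by linarith)] at this
    linarith
  · simp
  · rcases (show 0 ≤ F s from measureReal_nonneg).eq_or_lt with h | h
    · rw [← h]; positivity
    · refine hlog s h ?_
      have : sInf S ≤ (Real.log (F 0) - Real.log (F s)) / s :=
        csInf_le ⟨0, hS0⟩ ⟨s, ⟨hs, h⟩, rfl⟩
      rw [le_div_iff₀ hs] at this
      linarith

/-- Grünbaum's inequality, with the dimension-free constant `e`: a half-space whose boundary passes
through the centroid of a convex body contains at least the fraction `1 / e` of its volume. -/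
theorem volume_le_exp_mul_volume_inter_halfSpace (hL : IsCompact L) (hconv : Convex ℝ L)
    (h0 : (0 : EuclideanSpace ℝ (Fin n)) ∈ interior L) {ℓ : EuclideanSpace ℝ (Fin n) →L[ℝ] ℝ}
    (hℓ : ℓ ≠ 0) (hcent : ∫ y in L, ℓ y = 0) :
    volume.real L ≤ Real.exp 1 * volume.real (L ∩ {y | 0 ≤ ℓ y}) := by
  obtain ⟨k, hk, hexp⟩ := exists_exp_bound_volume_inter_halfSpace hL hconv h0 hℓ
  set p := volume.real (L ∩ {y | 0 ≤ ℓ y}) with hp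
  set V := volume.real L with hV
  have hp0 : 0 < p := by
    obtain ⟨b₀, hb₀, hFb₀⟩ := exists_pos_volume_inter_halfSpace_pos hL h0 hℓ
    exact hFb₀.trans_le (antitone_volume_inter_halfSpace hL ℓ hb₀.le)
  have hpV : p ≤ V := ENNReal.toReal_mono hL.measure_lt_top.ne (measure_mono inter_subset_left)
  have hV0 : 0 < V := hp0.trans_le hpV
  have hint : IntegrableOn (fun y => ℓ y) L := ℓ.continuous.continuousOn.integrableOn_compact hL
  rcases hk.eq_or_lt with rfl | hk
  · obtain ⟨a, ha⟩ := (hL.image ℓ.continuous).bddBelow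
    have : L ∩ {y | a ≤ ℓ y} = L := inter_eq_left.2 fun y hy => ha ⟨y, hy, rfl⟩
    have h := hexp a
    rw [this] at h
    simp only [zero_mul, neg_zero, Real.exp_zero, mul_one] at h
    refine h.trans (le_mul_of_one_le_left hp0.le ?_)
    exact Real.one_le_exp zero_le_one
  -- the exponential bound exceeds the total volume exactly to the left of `s₁`
  set s₁ := Real.log (p / V) / k with hs₁
  have hs₁k : Real.exp (-(k * s₁)) = V / p := by
    rw [hs₁, mul_div_cancel₀ _ hk.ne', Real.exp_neg, Real.exp_log (div_pos hp0 hV0), inv_div]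
  -- `∫_L (ℓ - s₁)` is `-s₁ V` by the centroid condition, and at most `V / k` by this estimate
  have hlay : ∫⁻ y in L, ENNReal.ofReal (max (ℓ y - s₁) 0) ≤ ENNReal.ofReal (V / k) := by
    rw [lintegral_eq_lintegral_meas_le _ (by filter_upwards with y; exact le_max_right _ _)
      (by fun_prop)]
    calc _ ≤ ∫⁻ t in Ioi (0 : ℝ), ENNReal.ofReal (V * Real.exp (-k * t)) := by
          refine setLIntegral_mono' measurableSet_Ioi fun t ht => ?_
          have hset : {y | t ≤ max (ℓ y - s₁) 0} = {y | s₁ + t ≤ ℓ y} := by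
            ext y
            simp only [mem_ofPred_eq, le_max_iff]
            constructor
            · rintro (h | h)
              · linarith
              · exact absurd h (not_le.2 ht)
            · intro h; left; linarith
          rw [hset, Measure.restrict_apply' hL.measurableSet, inter_comm,
            ← ENNReal.ofReal_toReal (volume_inter_halfSpace_ne_top hL ℓ _)]
          refine ENNReal.ofReal_le_ofReal ((hexp _).trans_eq ?_)
          rw [mul_add, neg_add, Real.exp_add, hs₁k, neg_mul]
          field_simp
      _ = ENNReal.ofReal (V / k) := by
          rw [← ofReal_integral_eq_lintegral_ofReal]
          · rw [integral_const_mul, integral_exp_mul_Ioi (by linarith)]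
            simp [div_eq_mul_inv]
          · exact (integrableOn_exp_mul_Ioi (by linarith) 0).const_mul V
          · filter_upwards with t; positivity
  have hint2 : IntegrableOn (fun y => max (ℓ y - s₁) 0) L := by
    refine ContinuousOn.integrableOn_compact hL ?_
    fun_prop
  rw [← ofReal_integral_eq_lintegral_ofReal hint2
    (by filter_upwards with y; exact le_max_right _ _),
    ENNReal.ofReal_le_ofReal_iff (by positivity)] at hlay
  have hconst : IntegrableOn (fun _ => s₁) L := by
    simp [hL.measure_lt_top]
  have hmean : ∫ y in L, (ℓ y - s₁) = -(s₁ * V) := by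
    rw [integral_sub hint hconst, hcent]
    simp [hV, Measure.real, mul_comm]
  have hle : -(s₁ * V) ≤ V / k := by
    rw [← hmean]
    refine le_trans (integral_mono ?_ hint2 fun y => le_max_left _ _) hlay
    exact hint.sub hconst
  have hlog : -1 ≤ Real.log (p / V) := by
    have h1 : Real.log (p / V) = k * s₁ := by rw [hs₁]; field_simp
    rw [le_div_iff₀ hk] at hle
    rw [h1]
    nlinarith
  have h := Real.exp_le_exp.2 hlog
  rw [Real.exp_log (div_pos hp0 hV0), Real.exp_neg, le_div_iff₀ hV0] at h
  rwa [← inv_mul_le_iff₀ (Real.exp_pos 1)]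

end Cap

/-! ### Polars with respect to a moving point -/

section Polar

variable {n : ℕ} {K : Set (EuclideanSpace ℝ (Fin n))} {x : EuclideanSpace ℝ (Fin n)}

theorem mem_polarAt_zero {y : EuclideanSpace ℝ (Fin n)} :
    y ∈ polarAt K 0 ↔ ∀ z ∈ K, inner ℝ y z ≤ 1 := by
  simp [polarAt]

theorem mem_polarAt {y : EuclideanSpace ℝ (Fin n)} :
    y ∈ polarAt K x ↔ ∀ z ∈ K, inner ℝ y z ≤ 1 + inner ℝ x y := by
  simp only [polarAt, mem_ofPred_eq, inner_sub_right, sub_le_iff_le_add, real_inner_comm x y]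

theorem isClosed_polarAt (K : Set (EuclideanSpace ℝ (Fin n))) (x : EuclideanSpace ℝ (Fin n)) :
    IsClosed (polarAt K x) := by
  have : polarAt K x = ⋂ z ∈ K, {y | inner ℝ y (z - x) ≤ 1} := by
    ext y
    simp [polarAt]
  rw [this]
  exact isClosed_biInter fun z _ => isClosed_le (by fun_prop) continuous_const

theorem convex_polarAt (K : Set (EuclideanSpace ℝ (Fin n))) (x : EuclideanSpace ℝ (Fin n)) :
    Convex ℝ (polarAt K x) := by
  intro y hy y' hy' a b ha hb hab z hz
  rw [inner_add_left, real_inner_smul_left, real_inner_smul_left]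
  nlinarith [hy z hz, hy' z hz]

theorem isCompact_polarAt_zero (h0 : (0 : EuclideanSpace ℝ (Fin n)) ∈ interior K) :
    IsCompact (polarAt K 0) := by
  obtain ⟨ε, hε, hball⟩ := Metric.mem_nhds_iff.1 (mem_interior_iff_mem_nhds.1 h0)
  refine Metric.isCompact_of_isClosed_isBounded (isClosed_polarAt K 0) ?_
  refine (Metric.isBounded_closedBall (x := 0) (r := 2 / ε)).subset fun y hy => ?_
  rw [mem_closedBall_zero_iff]
  rcases eq_or_ne y 0 with rfl | hy0
  · simp; positivity
  have hn : 0 < ‖y‖ := norm_pos_iff.2 hy0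
  have hz : (ε / 2 / ‖y‖) • y ∈ K := by
    refine hball ?_
    rw [mem_ball_zero_iff, norm_smul, Real.norm_of_nonneg (by positivity), div_mul_cancel₀ _ hn.ne']
    linarith
  have := mem_polarAt_zero.1 hy _ hz
  rw [real_inner_smul_right, real_inner_self_eq_norm_sq] at this
  rw [le_div_iff₀ hε]
  have e : ε / 2 / ‖y‖ * ‖y‖ ^ 2 = ε / 2 * ‖y‖ := by field_simp
  linarith

theorem zero_mem_interior_polarAt (hK : Bornology.IsBounded K) (x : EuclideanSpace ℝ (Fin n)) :
    (0 : EuclideanSpace ℝ (Fin n)) ∈ interior (polarAt K x) := by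
  obtain ⟨R, hR, hball⟩ := hK.exists_pos_norm_le
  have hR' : 0 < R + ‖x‖ := by positivity
  rw [mem_interior_iff_mem_nhds, Metric.mem_nhds_iff]
  refine ⟨1 / (R + ‖x‖), by positivity, fun y hy z hz => ?_⟩
  rw [mem_ball_zero_iff, lt_div_iff₀ hR'] at hy
  calc inner ℝ y (z - x) ≤ ‖y‖ * ‖z - x‖ := real_inner_le_norm y _
    _ ≤ ‖y‖ * (R + ‖x‖) := by
        gcongr
        exact (norm_sub_le z x).trans (by gcongr; exact hball z hz)
    _ ≤ 1 := hy.le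

theorem one_add_inner_pos_of_mem_polarAt (h0 : (0 : EuclideanSpace ℝ (Fin n)) ∈ interior K)
    {y : EuclideanSpace ℝ (Fin n)} (hy : y ∈ polarAt K x) : 0 < 1 + inner ℝ x y := by
  rw [mem_polarAt] at hy
  rcases eq_or_ne y 0 with rfl | hy0
  · simp
  obtain ⟨ε, hε, hball⟩ := Metric.mem_nhds_iff.1 (mem_interior_iff_mem_nhds.1 h0)
  have hn : 0 < ‖y‖ := norm_pos_iff.2 hy0
  have hz : (ε / 2 / ‖y‖) • y ∈ K := by
    refine hball ?_
    rw [mem_ball_zero_iff, norm_smul, Real.norm_of_nonneg (by positivity), div_mul_cancel₀ _ hn.ne']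
    linarith
  refine lt_of_lt_of_le ?_ (hy _ hz)
  rw [real_inner_smul_right, real_inner_self_eq_norm_sq]
  positivity

/-- The projective map `y ↦ y / (1 - ⟨x, y⟩)`, which carries the polar of `K` at the origin to the
polar of `K` at `x`. -/
noncomputable def polarShift (x y : EuclideanSpace ℝ (Fin n)) : EuclideanSpace ℝ (Fin n) :=
  (1 - inner ℝ x y)⁻¹ • y

theorem image_polarShift (h0 : (0 : EuclideanSpace ℝ (Fin n)) ∈ interior K)
    (hx : ∀ y ∈ polarAt K 0, inner ℝ x y < 1) : polarShift x '' polarAt K 0 = polarAt K x := by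
  ext w
  constructor
  · rintro ⟨y, hy, rfl⟩
    have hpos : 0 < 1 - inner ℝ x y := sub_pos.2 (hx y hy)
    rw [mem_polarAt]
    intro z hz
    rw [polarShift, real_inner_smul_left, real_inner_smul_right]
    have e : 1 + (1 - inner ℝ x y)⁻¹ * inner ℝ x y = (1 - inner ℝ x y)⁻¹ * 1 := by
      field_simp; ring
    rw [e]
    gcongr
    exact mem_polarAt_zero.1 hy z hz
  · intro hw
    have hpos := one_add_inner_pos_of_mem_polarAt h0 hw
    refine ⟨(1 + inner ℝ x w)⁻¹ • w, mem_polarAt_zero.2 fun z hz => ?_, ?_⟩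
    · rw [real_inner_smul_left, inv_mul_le_iff₀ hpos, mul_one]
      exact mem_polarAt.1 hw z hz
    · rw [polarShift, real_inner_smul_right, smul_smul]
      have e : (1 - (1 + inner ℝ x w)⁻¹ * inner ℝ x w)⁻¹ * (1 + inner ℝ x w)⁻¹ = 1 := by
        have e1 : 1 - (1 + inner ℝ x w)⁻¹ * inner ℝ x w = (1 + inner ℝ x w)⁻¹ := by
          field_simp; ring
        rw [e1, inv_inv, mul_inv_cancel₀ hpos.ne']
      rw [e, one_smul]

theorem injOn_polarShift : InjOn (polarShift x) {y | inner ℝ x y < 1} := by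
  intro y hy y' hy' h
  simp only [mem_ofPred_eq] at hy hy'
  have h1 : 1 - inner ℝ x y ≠ 0 := by linarith
  have h2 : 1 - inner ℝ x y' ≠ 0 := by linarith
  have hi := congrArg (fun w => inner ℝ x w) h
  simp only [polarShift, real_inner_smul_right] at hi
  have hxy : inner ℝ x y = inner ℝ x y' := by
    field_simp at hi
    linarith
  simp only [polarShift, hxy] at h
  exact smul_right_injective _ (inv_ne_zero h2) h

/-- Matrix determinant lemma for a rank-one perturbation of a multiple of the identity. -/
theorem det_smul_id_add_smulRight (c : ℝ) (hc : c ≠ 0) (f : EuclideanSpace ℝ (Fin n) →L[ℝ] ℝ)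
    (v : EuclideanSpace ℝ (Fin n)) :
    (c • ContinuousLinearMap.id ℝ (EuclideanSpace ℝ (Fin n)) + f.smulRight v).det =
      c ^ n * (1 + c⁻¹ * f v) := by
  have : ((c • ContinuousLinearMap.id ℝ (EuclideanSpace ℝ (Fin n)) + f.smulRight v :
      EuclideanSpace ℝ (Fin n) →L[ℝ] EuclideanSpace ℝ (Fin n)) :
      EuclideanSpace ℝ (Fin n) →ₗ[ℝ] EuclideanSpace ℝ (Fin n)) =
      c • LinearMap.transvection (c⁻¹ • (f : EuclideanSpace ℝ (Fin n) →ₗ[ℝ] ℝ)) v := by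
    ext1 w
    simp [LinearMap.transvection.apply, smul_smul, hc]
  rw [ContinuousLinearMap.det, this, LinearMap.det_smul, LinearMap.transvection.det]
  simp

theorem hasFDerivAt_polarShift {y : EuclideanSpace ℝ (Fin n)} (hy : 1 - inner ℝ x y ≠ 0) :
    HasFDerivAt (polarShift x) ((1 - inner ℝ x y)⁻¹ • ContinuousLinearMap.id ℝ _ +
      ((((1 - inner ℝ x y) ^ 2)⁻¹) • innerSL ℝ x).smulRight y) y := by
  have h1 : HasFDerivAt (fun y => 1 - inner ℝ x y) (-(innerSL ℝ x)) y :=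
    (innerSL ℝ x).hasFDerivAt.const_sub 1
  have h2 := (hasDerivAt_inv hy).comp_hasFDerivAt y h1
  have h3 := h2.smul (hasFDerivAt_id y)
  have e : -((1 - inner ℝ x y) ^ 2)⁻¹ • -innerSL ℝ x = ((1 - inner ℝ x y) ^ 2)⁻¹ • innerSL ℝ x := by
    rw [neg_smul_neg]
  rw [e] at h3
  exact h3

/-- Change of variables under `polarShift x`, whose Jacobian at `y` is `(1 - ⟨x, y⟩)⁻⁽ⁿ⁺¹⁾`. -/
theorem volume_polarAt_eq_lintegral (h0 : (0 : EuclideanSpace ℝ (Fin n)) ∈ interior K)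
    (hx : ∀ y ∈ polarAt K 0, inner ℝ x y < 1) :
    volume (polarAt K x) =
      ∫⁻ y in polarAt K 0, ENNReal.ofReal ((1 - inner ℝ x y) ^ (n + 1))⁻¹ := by
  have hm : MeasurableSet (polarAt K 0) := (isClosed_polarAt K 0).measurableSet
  rw [← image_polarShift h0 hx, ← lintegral_abs_det_fderiv_eq_addHaar_image volume hm
    (fun y hy => (hasFDerivAt_polarShift (sub_pos.2 (hx y hy)).ne').hasFDerivWithinAt)
    (injOn_polarShift.mono hx)]
  refine setLIntegral_congr_fun hm fun y hy => ?_
  have hpos : 0 < 1 - inner ℝ x y := sub_pos.2 (hx y hy)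
  have e : (1 - inner ℝ x y)⁻¹ ^ n * (1 + (1 - inner ℝ x y)⁻¹⁻¹ *
      ((((1 - inner ℝ x y) ^ 2)⁻¹) • innerSL ℝ x) y) = ((1 - inner ℝ x y) ^ (n + 1))⁻¹ := by
    simp only [smul_apply, innerSL_apply_apply, smul_eq_mul, inv_pow]
    field_simp
    ring
  simp only [det_smul_id_add_smulRight _ (inv_ne_zero hpos.ne'), e]
  rw [abs_of_pos (by positivity)]

/-- Second-order upper bound for `(1 - s)⁻⁽ⁿ⁺¹⁾`, by Bernoulli's inequality. -/
theorem inv_one_sub_pow_le {s : ℝ} (hs : (n + 1) * s ≤ 1 / 2) :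
    ((1 - s) ^ (n + 1))⁻¹ ≤ 1 + (n + 1) * s + 2 * ((n + 1) * s) ^ 2 := by
  have hs' : s ≤ 1 / 2 := by
    by_contra! h
    nlinarith [(Nat.cast_nonneg n : (0 : ℝ) ≤ n)]
  have hb := one_add_mul_le_pow (a := -s) (by linarith) (n + 1)
  push_cast at hb
  set w := (n + 1) * s with hw
  have hb' : 1 - w ≤ (1 - s) ^ (n + 1) := by
    rw [sub_eq_add_neg 1 s]; linarith
  refine (inv_anti₀ (by linarith) hb').trans ?_
  rw [inv_le_iff_one_le_mul₀ (by linarith)]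
  nlinarith [mul_nonneg (sq_nonneg w) (by linarith : 0 ≤ 1 - 2 * w)]

/-- First variation: compare `|K^0|` with `|K^{εv}|` and let `ε` tend to `0` from above. -/
theorem setIntegral_inner_polarAt_nonneg (h0 : (0 : EuclideanSpace ℝ (Fin n)) ∈ interior K)
    (hmin : ∀ x ∈ interior K, volume (polarAt K 0) ≤ volume (polarAt K x))
    (v : EuclideanSpace ℝ (Fin n)) : 0 ≤ ∫ y in polarAt K 0, inner ℝ v y := by
  have hL := isCompact_polarAt_zero h0
  set L := polarAt K 0 with hLdef
  set I := ∫ y in L, inner ℝ v y with hI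
  set J := ∫ y in L, (inner ℝ v y : ℝ) ^ 2 with hJ
  obtain ⟨M, hM⟩ := (hL.image (f := fun y => (inner ℝ v y : ℝ)) (by fun_prop)).bddAbove
  have hM' : ∀ y ∈ L, (inner ℝ v y : ℝ) ≤ M := fun y hy => hM ⟨y, hy, rfl⟩
  have hev1 : ∀ᶠ ε : ℝ in nhdsWithin 0 (Ioi 0), ε • v ∈ interior K := by
    have h : Continuous fun ε : ℝ => ε • v := by fun_prop
    have h' : Filter.Tendsto (fun ε : ℝ => ε • v) (nhds 0) (nhds 0) := by simpa using h.tendsto 0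
    exact (h'.eventually (isOpen_interior.mem_nhds h0)).filter_mono nhdsWithin_le_nhds
  have hev2 : ∀ᶠ ε : ℝ in nhdsWithin 0 (Ioi 0), (n + 1) * (ε * M) < 1 / 2 := by
    have h : Continuous fun ε : ℝ => (n + 1) * (ε * M) := by fun_prop
    have h' := h.tendsto 0
    simp only [zero_mul, mul_zero] at h'
    exact (h'.eventually (gt_mem_nhds (by norm_num))).filter_mono nhdsWithin_le_nhds
  have key : ∀ᶠ ε : ℝ in nhdsWithin 0 (Ioi 0), 0 ≤ (n + 1) * I + ε * (2 * (n + 1) ^ 2 * J) := by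
    filter_upwards [hev1, hev2, self_mem_nhdsWithin] with ε h1 h2 h3
    have hε : 0 < ε := h3
    have hw : ∀ y ∈ L, (n + 1) * (inner ℝ (ε • v) y : ℝ) ≤ 1 / 2 := by
      intro y hy
      rw [real_inner_smul_left]
      refine le_trans ?_ h2.le
      gcongr
      exact hM' y hy
    have hlt : ∀ y ∈ L, (inner ℝ (ε • v) y : ℝ) < 1 := by
      intro y hy
      have := hw y hy
      by_contra! h
      nlinarith [(Nat.cast_nonneg n : (0 : ℝ) ≤ n)]
    have hle := hmin _ h1
    rw [volume_polarAt_eq_lintegral h0 hlt] at hle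
    have hle2 := hle.trans (setLIntegral_mono' hL.measurableSet fun y hy =>
      ENNReal.ofReal_le_ofReal (inv_one_sub_pow_le (hw y hy)))
    have hi1 : IntegrableOn (fun y => (n + 1) * (inner ℝ (ε • v) y : ℝ)) L :=
      ContinuousOn.integrableOn_compact hL (by fun_prop)
    have hi2 : IntegrableOn (fun y => 2 * ((n + 1) * (inner ℝ (ε • v) y : ℝ)) ^ 2) L :=
      ContinuousOn.integrableOn_compact hL (by fun_prop)
    have hi0 : IntegrableOn (fun _ => (1 : ℝ)) L := by simp [hL.measure_lt_top]
    have hi01 : IntegrableOn (fun y => 1 + (n + 1) * (inner ℝ (ε • v) y : ℝ)) L := hi0.add hi1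
    have hnn : ∀ y, 0 ≤ 1 + (n + 1) * (inner ℝ (ε • v) y : ℝ) +
        2 * ((n + 1) * (inner ℝ (ε • v) y : ℝ)) ^ 2 := fun y => by
      nlinarith [sq_nonneg (1 + (n + 1) * (inner ℝ (ε • v) y : ℝ))]
    have hi : IntegrableOn (fun y => 1 + (n + 1) * (inner ℝ (ε • v) y : ℝ) +
        2 * ((n + 1) * (inner ℝ (ε • v) y : ℝ)) ^ 2) L :=
      ContinuousOn.integrableOn_compact hL (by fun_prop)
    rw [← ofReal_integral_eq_lintegral_ofReal hi (by filter_upwards with y; exact hnn y),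
      ← ENNReal.ofReal_toReal hL.measure_lt_top.ne,
      ENNReal.ofReal_le_ofReal_iff (integral_nonneg hnn), integral_add hi01 hi2,
      integral_add hi0 hi1] at hle2
    have e1 : ∫ y in L, (n + 1) * (inner ℝ (ε • v) y : ℝ) = ε * ((n + 1) * I) := by
      simp only [real_inner_smul_left, integral_const_mul, hI]; ring
    have e2 : ∫ y in L, 2 * ((n + 1) * (inner ℝ (ε • v) y : ℝ)) ^ 2 =
        ε * (ε * (2 * (n + 1) ^ 2 * J)) := by
      simp only [real_inner_smul_left, mul_pow, integral_const_mul, hJ]; ring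
    have e0 : ∫ _ in L, (1 : ℝ) = (volume L).toReal := by simp [Measure.real]
    rw [e0, e1, e2] at hle2
    by_contra! hneg
    nlinarith
  have hlim : Filter.Tendsto (fun ε : ℝ => (n + 1) * I + ε * (2 * (n + 1) ^ 2 * J))
      (nhdsWithin 0 (Ioi 0)) (nhds ((n + 1) * I)) := by
    have h : Continuous fun ε : ℝ => (n + 1) * I + ε * (2 * (n + 1) ^ 2 * J) := by fun_prop
    have h' := h.tendsto 0
    simp only [zero_mul, add_zero] at h'
    exact h'.mono_left nhdsWithin_le_nhds
  have := ge_of_tendsto hlim key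
  exact nonneg_of_mul_nonneg_right this (by positivity)

/-- If the volume of the polar is minimal at the origin, the polar at the origin has its centroid there. -/
theorem setIntegral_inner_polarAt_eq_zero (h0 : (0 : EuclideanSpace ℝ (Fin n)) ∈ interior K)
    (hmin : ∀ x ∈ interior K, volume (polarAt K 0) ≤ volume (polarAt K x))
    (v : EuclideanSpace ℝ (Fin n)) : ∫ y in polarAt K 0, inner ℝ v y = 0 := by
  refine le_antisymm ?_ (setIntegral_inner_polarAt_nonneg h0 hmin v)
  have := setIntegral_inner_polarAt_nonneg h0 hmin (-v)
  simp only [inner_neg_left, integral_neg] at this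
  linarith

/-- Adding to a point `y` of the cap `⟨x, y⟩ ≥ 0` of the polar at the origin a suitable multiple of
`y₀`, proportional to `⟨x, y⟩`, gives a point of the polar at `x`. -/
theorem add_smul_mem_polarAt {y y₀ : EuclideanSpace ℝ (Fin n)} (hy₀ : y₀ ∈ polarAt K 0)
    (hy : y ∈ polarAt K 0) (hxy : 0 ≤ inner ℝ x y) {a : ℝ} (ha : 0 ≤ a)
    (ha' : a * (1 - inner ℝ x y₀) ≤ 1) : y + (a * inner ℝ x y) • y₀ ∈ polarAt K x := by
  rw [mem_polarAt]
  intro z hz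
  have h1 := mem_polarAt_zero.1 hy z hz
  have h2 := mem_polarAt_zero.1 hy₀ z hz
  simp only [inner_add_left, inner_add_right, real_inner_smul_left, real_inner_smul_right]
  have h3 := mul_le_mul_of_nonneg_left h2 (mul_nonneg ha hxy)
  nlinarith [mul_le_mul_of_nonneg_left ha' hxy]

/-- The linear map `y ↦ y + a ⟨x, y⟩ y₀`, of determinant `1 + a ⟨x, y₀⟩`, sends the cap of the polar
at the origin into the polar at `x`. -/
theorem volume_inter_halfSpace_mul_le (x : EuclideanSpace ℝ (Fin n))
    {y₀ : EuclideanSpace ℝ (Fin n)} (hy₀ : y₀ ∈ polarAt K 0)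
    (hμ : 0 ≤ inner ℝ x y₀) {a : ℝ} (ha : 0 ≤ a) (ha' : a * (1 - inner ℝ x y₀) ≤ 1) :
    ENNReal.ofReal (1 + a * inner ℝ x y₀) *
      volume (polarAt K 0 ∩ {y | 0 ≤ innerSL ℝ x y}) ≤ volume (polarAt K x) := by
  set T := LinearMap.transvection (a • (innerSL ℝ x : EuclideanSpace ℝ (Fin n) →ₗ[ℝ] ℝ)) y₀
    with hT
  have hdet : T.det = 1 + a * inner ℝ x y₀ := by
    rw [hT, LinearMap.transvection.det]; simp
  have := Measure.addHaar_image_linearMap volume T (polarAt K 0 ∩ {y | 0 ≤ innerSL ℝ x y})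
  rw [hdet, abs_of_pos (by positivity)] at this
  rw [← this]
  refine measure_mono ?_
  rintro _ ⟨y, ⟨hy, hxy⟩, rfl⟩
  have e : T y = y + (a * inner ℝ x y) • y₀ := by
    simp [hT, LinearMap.transvection.apply]
  rw [e]
  exact add_smul_mem_polarAt hy₀ hy (by simpa using hxy) ha ha'

end Polar

/-! ### The volume of the polar of a symmetric body -/

section Symmetric

variable {n : ℕ} {K L : Set (EuclideanSpace ℝ (Fin n))} {x : EuclideanSpace ℝ (Fin n)}

/-- Contraction towards `y₀` by the factor `1 - t / ℓ y₀` sends the cap at level `0` into the cap at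
level `t`. -/
theorem pow_mul_volume_inter_halfSpace_le (hconv : Convex ℝ L)
    {ℓ : EuclideanSpace ℝ (Fin n) →L[ℝ] ℝ} {y₀ : EuclideanSpace ℝ (Fin n)} (hy₀ : y₀ ∈ L)
    {t : ℝ} (ht : 0 ≤ t) (htμ : t ≤ ℓ y₀) (hμ : 0 < ℓ y₀) :
    ENNReal.ofReal ((1 - t / ℓ y₀) ^ n) * volume (L ∩ {y | 0 ≤ ℓ y}) ≤
      volume (L ∩ {y | t ≤ ℓ y}) := by
  have hr : 0 ≤ 1 - t / ℓ y₀ := sub_nonneg.2 ((div_le_one hμ).2 htμ)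
  have h := Measure.addHaar_image_homothety volume y₀ (1 - t / ℓ y₀) (L ∩ {y | 0 ≤ ℓ y})
  rw [finrank_euclideanSpace_fin, abs_of_nonneg (pow_nonneg hr n)] at h
  rw [← h]
  refine measure_mono ?_
  rintro _ ⟨y, ⟨hy, hy'⟩, rfl⟩
  have e : AffineMap.homothety y₀ (1 - t / ℓ y₀) y = (1 - t / ℓ y₀) • y + (t / ℓ y₀) • y₀ := by
    rw [AffineMap.homothety_apply]
    simp only [vsub_eq_sub, vadd_eq_add]
    module
  rw [e]
  refine ⟨hconv hy hy₀ hr (by positivity) (by ring), ?_⟩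
  simp only [mem_ofPred_eq, map_add, map_smul, smul_eq_mul] at hy' ⊢
  rw [div_mul_cancel₀ _ hμ.ne']
  linarith [mul_nonneg hr hy']

theorem volume_inter_halfSpace_neg (hsymm : ∀ y ∈ L, -y ∈ L)
    (ℓ : EuclideanSpace ℝ (Fin n) →L[ℝ] ℝ) (t : ℝ) :
    volume (L ∩ {y | t ≤ -ℓ y}) = volume (L ∩ {y | t ≤ ℓ y}) := by
  rw [← Measure.measure_preimage_neg volume (L ∩ {y | t ≤ ℓ y})]
  congr 1
  ext y
  simp only [mem_inter_iff, mem_ofPred_eq, mem_preimage, map_neg]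
  exact and_congr_left fun _ => ⟨hsymm y, fun h => by simpa using hsymm _ h⟩

theorem pow_mul_volume_le_volume_le_abs (hL : MeasurableSet L) (hconv : Convex ℝ L)
    (hsymm : ∀ y ∈ L, -y ∈ L) {ℓ : EuclideanSpace ℝ (Fin n) →L[ℝ] ℝ}
    {y₀ : EuclideanSpace ℝ (Fin n)} (hy₀ : y₀ ∈ L)
    {t : ℝ} (ht : 0 < t) (htμ : t ≤ ℓ y₀) :
    ENNReal.ofReal ((1 - t / ℓ y₀) ^ n) * volume L ≤ volume (L ∩ {y | t ≤ |ℓ y|}) := by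
  have hhalf : volume L ≤ 2 * volume (L ∩ {y | 0 ≤ ℓ y}) := by
    have hsub : L ⊆ (L ∩ {y | 0 ≤ ℓ y}) ∪ (L ∩ {y | 0 ≤ -ℓ y}) := by
      intro y hy
      rcases le_total 0 (ℓ y) with h | h
      · exact Or.inl ⟨hy, h⟩
      · exact Or.inr ⟨hy, by simpa using h⟩
    refine (measure_mono hsub).trans ((measure_union_le _ _).trans_eq ?_)
    rw [volume_inter_halfSpace_neg hsymm, two_mul]
  calc ENNReal.ofReal ((1 - t / ℓ y₀) ^ n) * volume L
      ≤ ENNReal.ofReal ((1 - t / ℓ y₀) ^ n) * (2 * volume (L ∩ {y | 0 ≤ ℓ y})) := by gcongr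
    _ = 2 * (ENNReal.ofReal ((1 - t / ℓ y₀) ^ n) * volume (L ∩ {y | 0 ≤ ℓ y})) := by ring
    _ ≤ 2 * volume (L ∩ {y | t ≤ ℓ y}) := by
        gcongr
        exact pow_mul_volume_inter_halfSpace_le hconv hy₀ ht.le htμ (ht.trans_le htμ)
    _ = volume ((L ∩ {y | t ≤ ℓ y}) ∪ (L ∩ {y | t ≤ -ℓ y})) := by
        have hm : MeasurableSet (L ∩ {y | t ≤ -ℓ y}) :=
          hL.inter (measurableSet_le measurable_const (by fun_prop))
        rw [measure_union _ hm, volume_inter_halfSpace_neg hsymm, two_mul]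
        rw [Set.disjoint_left]
        rintro y ⟨_, h⟩ ⟨_, h'⟩
        simp only [mem_ofPred_eq] at h h'
        linarith
    _ ≤ volume (L ∩ {y | t ≤ |ℓ y|}) := by
        refine measure_mono ?_
        rintro y (⟨hy, h⟩ | ⟨hy, h⟩) <;> refine ⟨hy, ?_⟩ <;> simp only [mem_ofPred_eq] at h ⊢
        · exact h.trans (le_abs_self _)
        · exact h.trans (neg_le_abs _)

/-- The density `(1 - s)⁻⁽ⁿ⁺¹⁾ + (1 + s)⁻⁽ⁿ⁺¹⁾` whose integral over the polar body of a symmetric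
`K` is the sum of the volumes of the polars at `x` and `-x`. -/
noncomputable def evenDensity (n : ℕ) (s : ℝ) : ℝ :=
  ((1 - s) ^ (n + 1))⁻¹ + ((1 + s) ^ (n + 1))⁻¹

/-- The derivative of `evenDensity n`. -/
noncomputable def evenDensityDeriv (n : ℕ) (s : ℝ) : ℝ :=
  (n + 1) * (((1 - s) ^ (n + 2))⁻¹ - ((1 + s) ^ (n + 2))⁻¹)

theorem hasDerivAt_inv_one_sub_pow (m : ℕ) {s : ℝ} (hs : 1 - s ≠ 0) :
    HasDerivAt (fun s : ℝ => ((1 - s) ^ m)⁻¹) (m * ((1 - s) ^ (m + 1))⁻¹) s := by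
  have h := (((hasDerivAt_id s).const_sub 1).pow m).inv (pow_ne_zero m hs)
  refine h.congr_deriv ?_
  rcases m with _ | m
  · simp
  · simp only [id_eq, Nat.add_sub_cancel, Pi.pow_apply]
    field_simp
    ring

theorem hasDerivAt_inv_one_add_pow (m : ℕ) {s : ℝ} (hs : 1 + s ≠ 0) :
    HasDerivAt (fun s : ℝ => ((1 + s) ^ m)⁻¹) (-(m * ((1 + s) ^ (m + 1))⁻¹)) s := by
  have h := (((hasDerivAt_id s).const_add 1).pow m).inv (pow_ne_zero m hs)
  refine h.congr_deriv ?_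
  rcases m with _ | m
  · simp
  · simp only [id_eq, Nat.add_sub_cancel, Pi.pow_apply]
    field_simp
    ring

theorem hasDerivAt_evenDensity {s : ℝ} (hs : 1 - s ≠ 0) (hs' : 1 + s ≠ 0) :
    HasDerivAt (evenDensity n) (evenDensityDeriv n s) s := by
  have h := (hasDerivAt_inv_one_sub_pow (n + 1) hs).add (hasDerivAt_inv_one_add_pow (n + 1) hs')
  refine h.congr_deriv ?_
  rw [evenDensityDeriv]
  push_cast
  ring

theorem evenDensityDeriv_nonneg {s : ℝ} (h0 : 0 ≤ s) (h1 : s < 1) : 0 ≤ evenDensityDeriv n s := by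
  refine mul_nonneg (by positivity) (sub_nonneg.2 ?_)
  have : 0 < 1 - s := by linarith
  gcongr
  linarith

theorem continuousOn_evenDensityDeriv {μ : ℝ} (hμ : μ < 1) :
    ContinuousOn (evenDensityDeriv n) (Icc 0 μ) := by
  unfold evenDensityDeriv
  refine continuousOn_const.mul (ContinuousOn.sub ?_ ?_)
  · refine ContinuousOn.inv₀ (by fun_prop) fun s hs => pow_ne_zero _ ?_
    linarith [hs.2]
  · refine ContinuousOn.inv₀ (by fun_prop) fun s hs => pow_ne_zero _ ?_
    linarith [hs.1]

theorem integral_evenDensityDeriv {s : ℝ} (h0 : 0 ≤ s) (h1 : s < 1) :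
    ∫ u in (0 : ℝ)..s, evenDensityDeriv n u = evenDensity n s - 2 := by
  rw [intervalIntegral.integral_eq_sub_of_hasDerivAt (f := evenDensity n)]
  · norm_num [evenDensity]
  · intro u hu
    rw [uIcc_of_le h0] at hu
    exact hasDerivAt_evenDensity (by linarith [hu.2]) (by linarith [hu.1])
  · exact ((continuousOn_evenDensityDeriv h1).mono (by rw [uIcc_of_le h0])).intervalIntegrable

/-- An explicit primitive of `(1 - s / μ)ⁿ` times `evenDensityDeriv n`, found by integrating by parts and
then using that `((1 - s / μ) / (1 ∓ s))ⁿ` is a primitive of a multiple of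
`(1 - s / μ)ⁿ⁻¹ (1 ∓ s)⁻⁽ⁿ⁺¹⁾`. -/
theorem hasDerivAt_cone_primitive {μ s : ℝ} (h0 : 0 < μ) (h1 : μ < 1) (hs : 1 - s ≠ 0)
    (hs' : 1 + s ≠ 0) :
    HasDerivAt (fun s => (1 - s / μ) ^ n * (evenDensity n s - ((1 - s) ^ n)⁻¹ / (1 - μ) -
      ((1 + s) ^ n)⁻¹ / (1 + μ))) ((1 - s / μ) ^ n * evenDensityDeriv n s) s := by
  have hu : HasDerivAt (fun s : ℝ => (1 - s / μ) ^ n) (n * (1 - s / μ) ^ (n - 1) * (-(1 / μ))) s :=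
    (((hasDerivAt_id s).div_const μ).const_sub 1).pow n
  have h := hu.mul (((hasDerivAt_evenDensity (n := n) hs hs').sub
    ((hasDerivAt_inv_one_sub_pow n hs).div_const (1 - μ))).sub
    ((hasDerivAt_inv_one_add_pow n hs').div_const (1 + μ)))
  refine h.congr_deriv ?_
  rcases n with _ | m
  · simp
  have h1' : 1 - μ ≠ 0 := by linarith
  have h2' : 1 + μ ≠ 0 := by linarith
  simp only [Nat.add_sub_cancel, Pi.sub_apply, evenDensity, evenDensityDeriv]
  push_cast
  have e1 : ((1 - s) ^ (m + 1))⁻¹ = (1 - s) * ((1 - s) ^ (m + 1 + 1))⁻¹ := by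
    field_simp
    ring
  have e2 : ((1 + s) ^ (m + 1))⁻¹ = (1 + s) * ((1 + s) ^ (m + 1 + 1))⁻¹ := by
    field_simp
    ring
  have e3 : (1 - s / μ) ^ (m + 1) = (1 - s / μ) ^ m * (1 - s / μ) := pow_succ _ _
  rw [e1, e2, e3]
  generalize ((1 - s) ^ (m + 1 + 1))⁻¹ = A
  generalize ((1 + s) ^ (m + 1 + 1))⁻¹ = B
  generalize ((1 - s) ^ (m + 1 + 2))⁻¹ = A'
  generalize ((1 + s) ^ (m + 1 + 2))⁻¹ = B'
  generalize (1 - s / μ) ^ m = C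
  field_simp
  ring

/-- The value of the layer cake integral for a double cone with apices at `ℓ = ± μ`. -/
theorem integral_cone_evenDensityDeriv (hn : 1 ≤ n) {μ : ℝ} (h0 : 0 < μ) (h1 : μ < 1) :
    ∫ s in (0 : ℝ)..μ, (1 - s / μ) ^ n * evenDensityDeriv n s = 2 * (1 - μ ^ 2)⁻¹ - 2 := by
  rw [intervalIntegral.integral_eq_sub_of_hasDerivAt (fun u hu => hasDerivAt_cone_primitive h0 h1
    (by rw [uIcc_of_le h0.le] at hu; linarith [hu.2])
    (by rw [uIcc_of_le h0.le] at hu; linarith [hu.1]))]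
  · have h2 : 1 - μ ≠ 0 := by linarith
    have h3 : 1 + μ ≠ 0 := by linarith
    have h4 : 1 - μ ^ 2 = (1 - μ) * (1 + μ) := by ring
    rw [div_self h0.ne', sub_self, zero_pow (by omega), h4]
    simp only [evenDensity]
    norm_num
    field_simp
    ring
  · refine ContinuousOn.intervalIntegrable ?_
    rw [uIcc_of_le h0.le]
    exact ContinuousOn.mul (by fun_prop) (continuousOn_evenDensityDeriv h1)

/-- Among symmetric convex sets on which `ℓ` has maximum `ℓ y₀`, the integral of `evenDensity n` over the
set, relative to its volume, is smallest for a double cone. -/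
theorem lintegral_evenDensity_ge (hn : 1 ≤ n) (hL : MeasurableSet L) (hconv : Convex ℝ L)
    (hsymm : ∀ y ∈ L, -y ∈ L) {ℓ : EuclideanSpace ℝ (Fin n) →L[ℝ] ℝ}
    {y₀ : EuclideanSpace ℝ (Fin n)} (hy₀ : y₀ ∈ L) (hmax : ∀ y ∈ L, ℓ y ≤ ℓ y₀)
    (h0 : 0 < ℓ y₀) (h1 : ℓ y₀ < 1) :
    ENNReal.ofReal (2 * (1 - ℓ y₀ ^ 2)⁻¹) * volume L ≤
      ∫⁻ y in L, ENNReal.ofReal (evenDensity n (ℓ y)) := by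
  set μ := ℓ y₀ with hμ
  have habs : ∀ y ∈ L, |ℓ y| ≤ μ := fun y hy =>
    abs_le.2 ⟨by have := hmax _ (hsymm y hy); rw [map_neg] at this; linarith, hmax y hy⟩
  -- past `μ` the density is frozen, so that it stays integrable on every bounded interval
  set G : ℝ → ℝ := fun s => evenDensityDeriv n (min s μ) with hG
  have hGc : ContinuousOn G (Ici 0) := (continuousOn_evenDensityDeriv h1).comp (by fun_prop)
    fun s hs => ⟨le_min hs h0.le, min_le_right _ _⟩
  have hGi : ∀ s > 0, IntervalIntegrable G volume 0 s := fun s hs =>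
    (hGc.mono (by rw [uIcc_of_le hs.le]; exact Icc_subset_Ici_self)).intervalIntegrable
  have hG0 : ∀ s, 0 ≤ s → 0 ≤ G s := fun s hs =>
    evenDensityDeriv_nonneg (le_min hs h0.le) ((min_le_right _ _).trans_lt h1)
  have hlay := lintegral_comp_eq_lintegral_meas_le_mul (volume.restrict L) (f := fun y => |ℓ y|)
    (g := G) (by filter_upwards with y; exact abs_nonneg _) (by fun_prop) hGi
    ((ae_restrict_iff' measurableSet_Ioi).2 (by
      filter_upwards with s hs; exact hG0 s (le_of_lt hs)))
  have hdens : ∀ y ∈ L, ENNReal.ofReal (evenDensity n (ℓ y)) =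
      ENNReal.ofReal 2 + ENNReal.ofReal (∫ s in (0 : ℝ)..|ℓ y|, G s) := by
    intro y hy
    have e1 : ∫ s in (0 : ℝ)..|ℓ y|, G s = ∫ s in (0 : ℝ)..|ℓ y|, evenDensityDeriv n s := by
      refine intervalIntegral.integral_congr fun s hs => ?_
      rw [uIcc_of_le (abs_nonneg _)] at hs
      simp only [hG, min_eq_left (hs.2.trans (habs y hy))]
    have e2 : evenDensity n (ℓ y) = evenDensity n |ℓ y| := by
      rcases abs_cases (ℓ y) with ⟨h, _⟩ | ⟨h, _⟩
      · rw [h]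
      · rw [h, evenDensity, evenDensity]; ring_nf
    have h3 := integral_evenDensityDeriv (n := n) (abs_nonneg (ℓ y)) ((habs y hy).trans_lt h1)
    have h4 : 0 ≤ ∫ s in (0 : ℝ)..|ℓ y|, G s :=
      intervalIntegral.integral_nonneg (abs_nonneg _) fun s hs => hG0 s hs.1
    rw [← ENNReal.ofReal_add (by norm_num) h4, e1, h3, e2]
    congr 1; ring
  rw [setLIntegral_congr_fun hL hdens, lintegral_add_left measurable_const, hlay,
    setLIntegral_const]
  have hcone : ENNReal.ofReal (2 * (1 - μ ^ 2)⁻¹ - 2) * volume L ≤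
      ∫⁻ s in Ioi 0, volume.restrict L {y | s ≤ |ℓ y|} * ENNReal.ofReal (G s) := by
    have hii : IntegrableOn (fun s => (1 - s / μ) ^ n * evenDensityDeriv n s) (Ioc 0 μ) :=
      ((ContinuousOn.mul (by fun_prop) (continuousOn_evenDensityDeriv h1)).integrableOn_compact
        isCompact_Icc).mono_set Ioc_subset_Icc_self
    have hnn : ∀ s ∈ Ioc 0 μ, 0 ≤ (1 - s / μ) ^ n := fun s hs =>
      pow_nonneg (sub_nonneg.2 ((div_le_one h0).2 hs.2)) n
    rw [← integral_cone_evenDensityDeriv hn h0 h1, intervalIntegral.integral_of_le h0.le,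
      ofReal_integral_eq_lintegral_ofReal hii ((ae_restrict_iff' measurableSet_Ioc).2 (by
        filter_upwards with s hs
        exact mul_nonneg (hnn s hs) (evenDensityDeriv_nonneg hs.1.le (hs.2.trans_lt h1)))),
      ← lintegral_mul_const'' _ hii.aemeasurable.ennreal_ofReal]
    refine (setLIntegral_mono' measurableSet_Ioc fun s hs => ?_).trans
      (lintegral_mono_set Ioc_subset_Ioi_self)
    rw [Measure.restrict_apply' hL, inter_comm, hG]
    simp only [min_eq_left hs.2]
    rw [ENNReal.ofReal_mul (hnn s hs), mul_right_comm]
    gcongr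
    exact pow_mul_volume_le_volume_le_abs hL hconv hsymm hy₀ hs.1 hs.2
  have h5 : 0 ≤ 2 * (1 - μ ^ 2)⁻¹ - 2 := by
    have : 1 ≤ (1 - μ ^ 2)⁻¹ := (one_le_inv₀ (by nlinarith)).2 (by nlinarith)
    linarith
  calc ENNReal.ofReal (2 * (1 - μ ^ 2)⁻¹) * volume L
      = ENNReal.ofReal 2 * volume L + ENNReal.ofReal (2 * (1 - μ ^ 2)⁻¹ - 2) * volume L := by
        rw [← add_mul, ← ENNReal.ofReal_add (by norm_num) h5]
        congr 2; ring
    _ ≤ _ := by gcongr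

theorem neg_mem_polarAt_neg (hK : ∀ z ∈ K, -z ∈ K) {y : EuclideanSpace ℝ (Fin n)}
    (hy : y ∈ polarAt K x) : -y ∈ polarAt K (-x) := by
  rw [mem_polarAt] at hy ⊢
  intro z hz
  have := hy _ (hK z hz)
  simpa using this

theorem volume_polarAt_neg (hK : ∀ z ∈ K, -z ∈ K) (x : EuclideanSpace ℝ (Fin n)) :
    volume (polarAt K (-x)) = volume (polarAt K x) := by
  rw [← Measure.measure_preimage_neg volume (polarAt K x)]
  congr 1
  ext y
  exact ⟨fun h => by simpa using neg_mem_polarAt_neg hK h,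
    fun h => by simpa using neg_mem_polarAt_neg hK h⟩

/-- For symmetric `K` and `μ` the maximum of `⟨x, ·⟩` on `K^0`, one has `|K^x| ≥ |K^0| / (1 - μ²)`. -/
theorem inv_one_sub_sq_mul_volume_polarAt_le (hn : 1 ≤ n)
    (h0 : (0 : EuclideanSpace ℝ (Fin n)) ∈ interior K) (hK : ∀ z ∈ K, -z ∈ K)
    {y₀ : EuclideanSpace ℝ (Fin n)} (hy₀ : y₀ ∈ polarAt K 0)
    (hmax : ∀ y ∈ polarAt K 0, (inner ℝ x y : ℝ) ≤ inner ℝ x y₀) (hpos : 0 < (inner ℝ x y₀ : ℝ))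
    (hlt : (inner ℝ x y₀ : ℝ) < 1) :
    ENNReal.ofReal (1 - (inner ℝ x y₀ : ℝ) ^ 2)⁻¹ * volume (polarAt K 0) ≤
      volume (polarAt K x) := by
  have hm : MeasurableSet (polarAt K 0) := (isClosed_polarAt K 0).measurableSet
  have hsymm : ∀ y ∈ polarAt K 0, -y ∈ polarAt K 0 := fun y hy => by
    simpa using neg_mem_polarAt_neg hK hy
  have hx : ∀ y ∈ polarAt K 0, (inner ℝ x y : ℝ) < 1 := fun y hy => (hmax y hy).trans_lt hlt
  have hx' : ∀ y ∈ polarAt K 0, (inner ℝ (-x) y : ℝ) < 1 := fun y hy => by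
    simpa using hx _ (hsymm y hy)
  have h := lintegral_evenDensity_ge hn hm (convex_polarAt K 0) hsymm (ℓ := innerSL ℝ x) hy₀
    (by simpa using hmax) (by simpa using hpos) (by simpa using hlt)
  have e : ∫⁻ y in polarAt K 0, ENNReal.ofReal (evenDensity n (innerSL ℝ x y)) =
      volume (polarAt K x) + volume (polarAt K (-x)) := by
    rw [volume_polarAt_eq_lintegral h0 hx, volume_polarAt_eq_lintegral h0 hx',
      ← lintegral_add_left (by fun_prop)]
    refine setLIntegral_congr_fun hm fun y hy => ?_
    have h1 := sub_pos.2 (hx y hy)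
    have h2 := sub_pos.2 (hx' y hy)
    rw [← ENNReal.ofReal_add (by positivity) (by positivity), evenDensity]
    simp [sub_neg_eq_add]
  rw [e, volume_polarAt_neg hK, ← two_mul, ENNReal.ofReal_mul (by norm_num), mul_assoc,
    ENNReal.ofReal_ofNat] at h
  simp only [innerSL_apply_apply] at h
  exact (ENNReal.mul_le_mul_iff_right two_ne_zero ENNReal.ofNat_ne_top).1 h

end Symmetric

/-! ### Inclusions between the Santaló region and dilates of the body -/

section Inclusions

variable {n : ℕ} {K : Set (EuclideanSpace ℝ (Fin n))} {x : EuclideanSpace ℝ (Fin n)}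

/-- Bipolar theorem, in the form used to bound the Santaló region from outside. -/
theorem mem_smul_of_forall_inner_le (hconv : Convex ℝ K) (hcl : IsClosed K)
    (h0 : (0 : EuclideanSpace ℝ (Fin n)) ∈ K) {c : ℝ} (hc : 0 < c)
    (h : ∀ y ∈ polarAt K 0, (inner ℝ x y : ℝ) ≤ c) : x ∈ c • K := by
  by_contra hx
  obtain ⟨f, u, hf, hu⟩ := geometric_hahn_banach_closed_point (hconv.smul c)
    (hcl.smul_of_ne_zero hc.ne') hx
  have hu0 : 0 < u := by
    simpa using hf 0 ⟨0, h0, smul_zero c⟩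
  set w := (InnerProductSpace.toDual ℝ (EuclideanSpace ℝ (Fin n))).symm f with hw
  have hfw : ∀ z, inner ℝ w z = f z := fun z => InnerProductSpace.toDual_symm_apply
  have hy : (c / u) • w ∈ polarAt K 0 := by
    rw [mem_polarAt_zero]
    intro z hz
    have := hf (c • z) (smul_mem_smul_set hz)
    rw [map_smul, smul_eq_mul] at this
    rw [real_inner_smul_left, hfw, div_mul_eq_mul_div, div_le_one hu0]
    exact this.le
  have := h _ hy
  rw [real_inner_smul_right, real_inner_comm, hfw, div_mul_eq_mul_div, div_le_iff₀ hu0] at this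
  exact absurd (le_of_mul_le_mul_left this hc) (not_le.2 hu)

/-- If `⟨x, ·⟩` reached `1` on the polar, the polar at `x` would contain images of the cap under linear
maps of arbitrarily large determinant. -/
theorem inner_lt_one_of_volume_polarAt_ne_top (hK : Bornology.IsBounded K)
    (h0 : (0 : EuclideanSpace ℝ (Fin n)) ∈ interior K) (hx : volume (polarAt K x) ≠ ∞) :
    ∀ y ∈ polarAt K 0, (inner ℝ x y : ℝ) < 1 := by
  intro y₀ hy₀
  by_contra! hge
  have hℓ : innerSL ℝ x ≠ 0 := by
    intro h
    have h' : (inner ℝ x y₀ : ℝ) = 0 := by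
      rw [← innerSL_apply_apply ℝ x y₀, h]; rfl
    linarith
  have hL := isCompact_polarAt_zero h0
  obtain ⟨b, hb, hpos⟩ :=
    exists_pos_volume_inter_halfSpace_pos hL (zero_mem_interior_polarAt hK 0) hℓ
  have hp : 0 < volume.real (polarAt K 0 ∩ {y | 0 ≤ innerSL ℝ x y}) :=
    hpos.trans_le (antitone_volume_inter_halfSpace hL _ hb.le)
  set p := volume.real (polarAt K 0 ∩ {y | 0 ≤ innerSL ℝ x y}) with hpdef
  set P := volume.real (polarAt K x) with hP
  have key : ∀ a : ℝ, 0 ≤ a → (1 + a) * p ≤ P := by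
    intro a ha
    have h := ENNReal.toReal_mono hx (volume_inter_halfSpace_mul_le x hy₀ (by linarith) ha
      (by nlinarith))
    rw [ENNReal.toReal_mul, ENNReal.toReal_ofReal (by nlinarith)] at h
    refine le_trans ?_ h
    change (1 + a) * p ≤ (1 + a * inner ℝ x y₀) * p
    gcongr
    nlinarith
  have h := key (P / p) (div_nonneg measureReal_nonneg hp.le)
  rw [add_mul, div_mul_cancel₀ _ hp.ne'] at h
  linarith

/-- The contrapositive of the fact that `|K^x| = ∞` for `x` on the boundary of `K` or outside `K`. -/
theorem mem_interior_of_volume_polarAt_ne_top (hconv : Convex ℝ K) (hK : IsCompact K)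
    (h0 : (0 : EuclideanSpace ℝ (Fin n)) ∈ interior K) (hx : volume (polarAt K x) ≠ ∞) :
    x ∈ interior K := by
  have hlt := inner_lt_one_of_volume_polarAt_ne_top hK.isBounded h0 hx
  have hL := isCompact_polarAt_zero h0
  have h0L := interior_subset (zero_mem_interior_polarAt hK.isBounded 0)
  obtain ⟨y₀, hy₀, hmax⟩ := hL.exists_isMaxOn ⟨0, h0L⟩
    (f := fun y => (inner ℝ x y : ℝ)) (by fun_prop)
  have hmax' : ∀ y ∈ polarAt K 0, (inner ℝ x y : ℝ) ≤ inner ℝ x y₀ := fun y hy => hmax hy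
  set c := max (inner ℝ x y₀ : ℝ) (1 / 2) with hc
  have hc0 : 0 < c := lt_max_of_lt_right (by norm_num)
  have hc1 : c < 1 := max_lt (hlt _ hy₀) (by norm_num)
  obtain ⟨z, hz, hzx⟩ := mem_smul_of_forall_inner_le hconv hK.isClosed (interior_subset h0) hc0
    fun y hy => (hmax' y hy).trans (le_max_left _ _)
  have := hconv.combo_interior_self_mem_interior h0 hz (sub_pos.2 hc1) hc0.le (by ring)
  rw [← hzx]
  simpa using this

/-- Lower bound for `|K^x|` when the origin is the Santaló point of `K`. -/
theorem volume_polarAt_zero_le_exp_mul (hK : Bornology.IsBounded K)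
    (h0 : (0 : EuclideanSpace ℝ (Fin n)) ∈ interior K)
    (hmin : ∀ x ∈ interior K, volume (polarAt K 0) ≤ volume (polarAt K x))
    (hx : volume (polarAt K x) ≠ ∞) {y₀ : EuclideanSpace ℝ (Fin n)} (hy₀ : y₀ ∈ polarAt K 0)
    (hpos : 0 < (inner ℝ x y₀ : ℝ)) :
    volume.real (polarAt K 0) ≤
      Real.exp 1 * ((1 - inner ℝ x y₀) * volume.real (polarAt K x)) := by
  have hlt := inner_lt_one_of_volume_polarAt_ne_top hK h0 hx y₀ hy₀
  have hℓ : innerSL ℝ x ≠ 0 := by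
    intro h
    have h' : (inner ℝ x y₀ : ℝ) = 0 := by
      rw [← innerSL_apply_apply ℝ x y₀, h]; rfl
    linarith
  refine (volume_le_exp_mul_volume_inter_halfSpace (isCompact_polarAt_zero h0) (convex_polarAt K 0)
    (zero_mem_interior_polarAt hK 0) hℓ
    (by simpa using setIntegral_inner_polarAt_eq_zero h0 hmin x)).trans ?_
  have h1 : 0 < 1 - (inner ℝ x y₀ : ℝ) := by linarith
  have h := ENNReal.toReal_mono hx (volume_inter_halfSpace_mul_le x hy₀ hpos.le
    (inv_nonneg.2 h1.le) (inv_mul_cancel₀ h1.ne').le)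
  rw [ENNReal.toReal_mul, ENNReal.toReal_ofReal (by positivity)] at h
  have e : 1 + (1 - (inner ℝ x y₀ : ℝ))⁻¹ * inner ℝ x y₀ = (1 - (inner ℝ x y₀ : ℝ))⁻¹ := by
    field_simp; ring
  rw [e, inv_mul_le_iff₀ h1] at h
  gcongr
  exact h

theorem volume_polarAt_smul_le (hconv : Convex ℝ K) {z : EuclideanSpace ℝ (Fin n)} (hz : z ∈ K)
    {q : ℝ} (hq : 0 < q) (hq1 : q ≤ 1) :
    volume (polarAt K ((1 - q) • z)) ≤ ENNReal.ofReal (q ^ n)⁻¹ * volume (polarAt K 0) := by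
  have hsub : polarAt K ((1 - q) • z) ⊆ q⁻¹ • polarAt K 0 := by
    intro y hy
    rw [mem_inv_smul_set_iff₀ hq.ne', mem_polarAt_zero]
    intro w hw
    have := hy _ (hconv hz hw (sub_nonneg.2 hq1) hq.le (by ring))
    rwa [add_sub_cancel_left, real_inner_smul_right, ← real_inner_smul_left] at this
  refine (measure_mono hsub).trans_eq ?_
  rw [Measure.addHaar_smul, finrank_euclideanSpace_fin, inv_pow, abs_of_pos (by positivity)]

end Inclusions

section Santalo

variable {n : ℕ} {K : Set (EuclideanSpace ℝ (Fin n))} {x : EuclideanSpace ℝ (Fin n)} {t : ℝ}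

theorem ballVolume_ne_zero (n : ℕ) : ballVolume n ≠ 0 :=
  (Metric.measure_closedBall_pos volume _ one_pos).ne'

theorem ballVolume_ne_top (n : ℕ) : ballVolume n ≠ ∞ :=
  measure_closedBall_lt_top.ne

theorem ballVolume_toReal_pos (n : ℕ) : 0 < (ballVolume n).toReal :=
  ENNReal.toReal_pos (ballVolume_ne_zero n) (ballVolume_ne_top n)

/-- With finite volumes, membership in the Santaló region is an inequality between real numbers.
Finiteness of `|K^x|` has to be kept as a conjunct, since `volume.real` sends `∞` to `0`. -/
theorem mem_santaloRegion_iff (hK : 0 < volume.real K) (ht : 0 < t) :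
    x ∈ santaloRegion K t ↔ x ∈ K ∧ volume (polarAt K x) ≠ ∞ ∧
      volume.real K * volume.real (polarAt K x) ≤ t * (ballVolume n).toReal ^ 2 := by
  have hK0 : volume K ≠ 0 := fun h => by simp [Measure.real, h] at hK
  have hKt : volume K ≠ ∞ := fun h => by simp [Measure.real, h] at hK
  have hb0 := ballVolume_ne_zero n
  have hbt := ballVolume_ne_top n
  refine and_congr_right fun _ => ?_
  rw [ENNReal.div_le_iff (pow_ne_zero 2 hb0) (ENNReal.pow_ne_top hbt)]
  rcases eq_or_ne (volume (polarAt K x)) ∞ with h | h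
  · have : ENNReal.ofReal t * ballVolume n ^ 2 ≠ ∞ :=
      ENNReal.mul_ne_top ENNReal.ofReal_ne_top (ENNReal.pow_ne_top hbt)
    simp [h, ENNReal.mul_top hK0, this]
  · rw [← ENNReal.toReal_le_toReal (ENNReal.mul_ne_top hKt h)
      (ENNReal.mul_ne_top ENNReal.ofReal_ne_top (ENNReal.pow_ne_top hbt))]
    simp [h, Measure.real, ENNReal.toReal_ofReal ht.le]

end Santalo

theorem theorem9 (n : ℕ) (hn : 1 ≤ n) (K : ConvexBody (EuclideanSpace ℝ (Fin n)))
    (hint : (interior (K : Set (EuclideanSpace ℝ (Fin n)))).Nonempty)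
    (hK : IsSantaloPoint (K : Set (EuclideanSpace ℝ (Fin n))) 0)
    (t : ℝ) (ht : (santaloRegion (K : Set (EuclideanSpace ℝ (Fin n))) t).Nonempty) :
    ((1 - santaloRatio (K : Set (EuclideanSpace ℝ (Fin n))) t ^ (1 / (n : ℝ))) •
          (K : Set (EuclideanSpace ℝ (Fin n))) ⊆ santaloRegion K t ∧
      santaloRegion (K : Set (EuclideanSpace ℝ (Fin n))) t ⊆
        (1 - santaloRatio (K : Set (EuclideanSpace ℝ (Fin n))) t / Real.exp 1) •
          (K : Set (EuclideanSpace ℝ (Fin n)))) ∧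
    ((∀ x ∈ (K : Set (EuclideanSpace ℝ (Fin n))), -x ∈ (K : Set (EuclideanSpace ℝ (Fin n)))) →
      (1 - santaloRatio (K : Set (EuclideanSpace ℝ (Fin n))) t ^ (1 / (n : ℝ))) •
          (K : Set (EuclideanSpace ℝ (Fin n))) ⊆ santaloRegion K t ∧
      santaloRegion (K : Set (EuclideanSpace ℝ (Fin n))) t ⊆
        ((1 - santaloRatio (K : Set (EuclideanSpace ℝ (Fin n))) t) ^ (1 / 2 : ℝ)) •
          (K : Set (EuclideanSpace ℝ (Fin n)))) := by
  obtain ⟨h0, hmin'⟩ := hK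
  have hconv : Convex ℝ (K : Set (EuclideanSpace ℝ (Fin n))) := K.convex
  have hcomp : IsCompact (K : Set (EuclideanSpace ℝ (Fin n))) := K.isCompact
  generalize (K : Set (EuclideanSpace ℝ (Fin n))) = C at *
  have h0C : (0 : EuclideanSpace ℝ (Fin n)) ∈ C := interior_subset h0
  have hCt : volume C ≠ ∞ := hcomp.measure_lt_top.ne
  have hC0 : volume C ≠ 0 := (isOpen_interior.measure_pos volume hint |>.trans_le
    (measure_mono interior_subset)).ne'
  have hk : 0 < volume.real C := ENNReal.toReal_pos hC0 hCt
  have hmin : ∀ x ∈ interior C, volume (polarAt C 0) ≤ volume (polarAt C x) := fun x hx =>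
    (ENNReal.mul_le_mul_iff_right hC0 hCt).1 (hmin' x hx)
  have hL := isCompact_polarAt_zero h0
  have hLpos : ∀ x, volume (polarAt C x) ≠ 0 := fun x =>
    (isOpen_interior.measure_pos volume ⟨0, zero_mem_interior_polarAt hcomp.isBounded x⟩ |>.trans_le
      (measure_mono interior_subset)).ne'
  have hl : 0 < volume.real (polarAt C 0) := ENNReal.toReal_pos (hLpos 0) hL.measure_lt_top.ne
  have hb := ballVolume_toReal_pos n
  obtain ⟨x₁, hx₁⟩ := ht
  have ht0 : 0 < t := by
    by_contra! h
    have h2 := hx₁.2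
    rw [ENNReal.ofReal_of_nonpos h, nonpos_iff_eq_zero, ENNReal.div_eq_zero_iff, mul_eq_zero] at h2
    rcases h2 with (h2 | h2) | h2
    · exact hC0 h2
    · exact hLpos _ h2
    · exact ENNReal.pow_ne_top (ballVolume_ne_top n) h2
  set r := santaloRatio C t with hr
  have hrdef : r = volume.real C * volume.real (polarAt C 0) / (t * (ballVolume n).toReal ^ 2) := rfl
  have hr0 : 0 < r := by rw [hrdef]; positivity
  have hmem : ∀ x, x ∈ santaloRegion C t ↔ x ∈ C ∧ volume (polarAt C x) ≠ ∞ ∧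
      r * volume.real (polarAt C x) ≤ volume.real (polarAt C 0) := by
    intro x
    rw [mem_santaloRegion_iff hk ht0, hrdef, div_mul_eq_mul_div, div_le_iff₀ (by positivity),
      mul_right_comm, mul_comm (volume.real (polarAt C 0)), mul_le_mul_iff_left₀ hl]
  -- a point of the region has finite polar volume, so it is interior and the minimality applies
  have hr1 : r ≤ 1 := by
    obtain ⟨_, hx1, hx2⟩ := (hmem x₁).1 hx₁
    have h := ENNReal.toReal_mono hx1
      (hmin x₁ (mem_interior_of_volume_polarAt_ne_top hconv hcomp h0 hx1))
    change volume.real (polarAt C 0) ≤ volume.real (polarAt C x₁) at h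
    by_contra! hcon
    nlinarith
  have inner_incl : (1 - r ^ (1 / (n : ℝ))) • C ⊆ santaloRegion C t := by
    rintro _ ⟨z, hz, rfl⟩
    set q := r ^ (1 / (n : ℝ)) with hq
    have hq0 : 0 < q := Real.rpow_pos_of_pos hr0 _
    have hq1 : q ≤ 1 := Real.rpow_le_one hr0.le hr1 (by positivity)
    have hqn : q ^ n = r := by
      rw [hq, one_div, Real.rpow_inv_natCast_pow hr0.le (by omega)]
    have hle := volume_polarAt_smul_le hconv hz hq0 hq1
    rw [hqn] at hle
    have htop := ENNReal.mul_ne_top (ENNReal.ofReal_ne_top (r := r⁻¹))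
      (hL.measure_lt_top (μ := volume)).ne
    refine (hmem _).2 ⟨?_, ne_top_of_le_ne_top htop hle, ?_⟩
    · have := hconv h0C hz hq0.le (sub_nonneg.2 hq1) (by ring)
      simpa using this
    · have h := ENNReal.toReal_mono htop hle
      rw [ENNReal.toReal_mul, ENNReal.toReal_ofReal (by positivity)] at h
      exact (le_inv_mul_iff₀ hr0).1 h
  refine ⟨⟨inner_incl, fun x hx => ?_⟩, fun hsymm => ⟨inner_incl, fun x hx => ?_⟩⟩
  · obtain ⟨_, hx1, hx2⟩ := (hmem x).1 hx
    have hc : 0 < 1 - r / Real.exp 1 := by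
      rw [sub_pos, div_lt_one (Real.exp_pos 1)]
      exact hr1.trans_lt (Real.one_lt_exp_iff.2 one_pos)
    refine mem_smul_of_forall_inner_le hconv hcomp.isClosed h0C hc fun y hy => ?_
    by_contra! hcon
    have h := volume_polarAt_zero_le_exp_mul hcomp.isBounded h0 hmin hx1 hy (hc.trans hcon)
    have hp : 0 < volume.real (polarAt C x) := ENNReal.toReal_pos (hLpos x) hx1
    have h2 : r ≤ Real.exp 1 * (1 - inner ℝ x y) := by
      refine le_of_mul_le_mul_right ?_ hp
      linarith
    rw [sub_lt_comm, lt_div_iff₀ (Real.exp_pos 1)] at hcon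
    linarith
  · obtain ⟨_, hx1, hx2⟩ := (hmem x).1 hx
    rcases eq_or_ne x 0 with rfl | hx0
    · exact ⟨0, h0C, smul_zero _⟩
    have hlt := inner_lt_one_of_volume_polarAt_ne_top hcomp.isBounded h0 hx1
    have h0L := zero_mem_interior_polarAt hcomp.isBounded 0
    obtain ⟨y₀, hy₀, hmax'⟩ := hL.exists_isMaxOn ⟨0, interior_subset h0L⟩
      (f := fun y => (inner ℝ x y : ℝ)) (by fun_prop)
    have hmax : ∀ y ∈ polarAt C 0, (inner ℝ x y : ℝ) ≤ inner ℝ x y₀ := fun y hy => hmax' hy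
    have hpos : 0 < (inner ℝ x y₀ : ℝ) := by
      have hℓ : innerSL ℝ x ≠ 0 := fun h => hx0 (by
        rw [← inner_self_eq_zero (𝕜 := ℝ), ← innerSL_apply_apply ℝ x x, h]; rfl)
      obtain ⟨b, hb, hv⟩ := exists_pos_volume_inter_halfSpace_pos hL h0L hℓ
      obtain ⟨y, hy, hby⟩ := nonempty_of_measure_ne_zero fun h =>
        hv.ne' (by rw [Measure.real, h]; rfl)
      exact hb.trans_le (le_trans (by simpa using hby) (hmax y hy))
    have h := ENNReal.toReal_mono hx1
      (inv_one_sub_sq_mul_volume_polarAt_le hn h0 hsymm hy₀ hmax hpos (hlt _ hy₀))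
    have h1 : 0 < 1 - (inner ℝ x y₀ : ℝ) ^ 2 := by nlinarith [hlt _ hy₀]
    rw [ENNReal.toReal_mul, ENNReal.toReal_ofReal (by positivity), inv_mul_le_iff₀ h1] at h
    have hp : 0 < volume.real (polarAt C x) := ENNReal.toReal_pos (hLpos x) hx1
    have h2 : r ≤ 1 - (inner ℝ x y₀ : ℝ) ^ 2 := le_of_mul_le_mul_right (hx2.trans h) hp
    rw [← Real.sqrt_eq_rpow]
    -- this also gives `0 < √(1 - r)`, without which the bipolar theorem does not apply
    have h3 : (inner ℝ x y₀ : ℝ) ≤ √(1 - r) := Real.le_sqrt_of_sq_le (by linarith)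
    exact mem_smul_of_forall_inner_le hconv hcomp.isClosed h0C (hpos.trans_le h3)
      fun y hy => (hmax y hy).trans h3
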